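/- For a profinite group $G$, a finite field $F$ and $n\ge 1$, let $r^\ast(G,F,n)$ be the number of isomorphism classes of absolutely irreducible continuous representations of $G$ of dimension $n$ over $F$. The group $G$ has UBERG (uniformly bounded exponential representation growth) if there is a constant $c>0$ with $r^\ast(G,F,n)\le |F|^{cn}$ for all finite fields $F$ and all $n$. Put $$\zeta_G(s)=\exp\Bigl(\sum_{p\text{ prime}}\sum_{n=1}^\infty\sum_{j=1}^\infty \frac{r^\ast(G,\mathbb F_{p^j},n)}{j}\,p^{-snj}\,|\mathbb P^{n-1}(\mathbb F_{p^j})|\Bigr),\qquad a(G)=\inf\{t\in\mathbb R_{\ge 1} : \zeta_G(t)\text{ converges}\}\in[1,\infty],$$ where $\inf\emptyset=\infty$. Let $G$ be a profinite group. If $G$ has UBERG, then $a(G)$ is a real number $\geq 1$. Moreover, whether or not $G$ has UBERG (with the obvious conventions for the value $\infty$): (i) If $H$ is an open subgroup of $G$, then $$\frac{a(H)}{|G:H|}\le a(G)\le a(H)+1-\frac1{|G:H|}.$$ If $G\cong H\times F$ as topological groups, where $H$ is a profinite group and $F$ is a finite group, then $a(G)=a(H)$. (ii) If $K$ is a closed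 normal subgroup of $G$, then $a(G/K)\le a(G)$. If moreover the quotient map $G\to G/K$ splits, i.e. has a continuous homomorphic section, then $a(G)\le a(K)+a(G/K)+1$. In particular, $a(G)=1$ if $G$ is finite. -/

import Mathlib

open scoped ENNReal TensorProduct LinearAlgebra.Projectivization

noncomputable section

namespace WeilZeta

universe u v

/-- Extension of scalars of a linear representation `ρ` of `G` over `F` to an algebraic closure
of `F`: the group acts on `F̄ ⊗ V` through the second factor. -/
def extendScalars {G : Type u} [Group G] {F : Type v} [Field F] {V : Type v} [AddCommGroup V]
    [Module F V] (ρ : Representation F G V) :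
    Representation (AlgebraicClosure F) G (AlgebraicClosure F ⊗[F] V) :=
  ((Module.End.baseChangeHom F (AlgebraicClosure F) V : _ →ₐ[F] _) : _ →* _).comp ρ

/-- A representation is absolutely irreducible if it is irreducible and remains irreducible over
an algebraic closure. -/
def IsAbsolutelyIrreducible {G : Type u} [Group G] {F : Type v} [Field F] {V : Type v}
    [AddCommGroup V] [Module F V] (ρ : Representation F G V) : Prop :=
  ρ.IsIrreducible ∧ (extendScalars ρ).IsIrreducible

/-- The absolutely irreducible continuous representations of the topological group `G` on the
discrete space `F ^ n`. For a discrete finite-dimensional space, continuity of the representation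
means that its kernel is open. -/
def AbsIrrep (G : Type u) [Group G] [TopologicalSpace G] (F : Type v) [Field F] (n : ℕ) :
    Type (max u v) :=
  {ρ : Representation F G (Fin n → F) //
    IsOpen {g : G | ρ g = 1} ∧ IsAbsolutelyIrreducible ρ}

/-- Isomorphism of representations. -/
instance AbsIrrep.setoid (G : Type u) [Group G] [TopologicalSpace G] (F : Type v) [Field F]
    (n : ℕ) : Setoid (AbsIrrep G F n) where
  r ρ σ := Nonempty (Representation.Equiv ρ.1 σ.1)
  iseqv :=
    { refl := fun ρ => ⟨Representation.Equiv.refl ρ.1⟩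
      symm := fun ⟨e⟩ => ⟨e.symm⟩
      trans := fun ⟨e⟩ ⟨f⟩ => ⟨e.trans f⟩ }

/-- `rStar G F n` is the number (possibly infinite) of isomorphism classes of absolutely
irreducible continuous `n`-dimensional representations of `G` over `F`. -/
def rStar (G : Type u) [Group G] [TopologicalSpace G] (F : Type v) [Field F] (n : ℕ) : ℕ∞ :=
  ENat.card (Quotient (AbsIrrep.setoid G F n))

/-- `G` has uniformly bounded exponential representation growth over finite fields. -/
def UBERG (G : Type u) [Group G] [TopologicalSpace G] : Prop :=
  ∃ c : ℝ, 0 < c ∧ ∀ (F : Type) [Field F] [Finite F] (n : ℕ),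
    (rStar G F n : ℝ≥0∞) ≤ (Nat.card F : ℝ≥0∞) ^ (c * n)

/-- The number of points of the projective space of dimension `n - 1` over a field `F`. -/
def projCard (F : Type v) [Field F] (n : ℕ) : ℕ := Nat.card (ℙ F (Fin n → F))

/-- The value in `[0, ∞]` at the real number `t` of the series
`∑_p ∑_{n ≥ 1} ∑_{j ≥ 1} (r*(G, 𝔽_{p^j}, n) / j) p^{-tnj} |ℙ^{n-1}(𝔽_{p^j})|`
whose exponential is `ζ_G(t)`. -/
def logZeta (G : Type u) [Group G] [TopologicalSpace G] (t : ℝ) : ℝ≥0∞ :=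
  ∑' (p : Nat.Primes) (n : ℕ+) (j : ℕ+),
    haveI : Fact (p : ℕ).Prime := ⟨p.2⟩
    (rStar G (GaloisField p j) n : ℝ≥0∞) / (j : ℕ) *
      ((p : ℕ) : ℝ≥0∞) ^ (-(t * (n : ℕ) * (j : ℕ))) *
      (projCard (GaloisField p j) n : ℝ≥0∞)

/-- The abscissa of convergence `a(G) = inf {t ≥ 1 | ζ_G(t) converges}`. The terms of the series
are nonnegative, so it converges at `t` exactly if its sum in `[0, ∞]` is finite. The infimum is
taken in the extended reals: it is `⊤` if there is no such real number `t`. -/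
def abscissa (G : Type u) [Group G] [TopologicalSpace G] : EReal :=
  sInf ((fun t : ℝ => (t : EReal)) '' {t : ℝ | 1 ≤ t ∧ logZeta G t < ⊤})

end WeilZeta

end

/-! Put q = |F|. Since |ℙ^{n-1}(F)| lies between q^{n-1} and 2q^{n-1}, the logarithm of ζ_G(t) is,
up to a factor 2 and the denominators j, the sum of q^{-tn+n-1} over absolutely irreducible
representations, that is, over irreducible ones with only scalar endomorphisms. Restriction to
another group leads out of this class, so all irreducible representations over F are admitted. One
of dimension n whose endomorphism field has degree l over F is an absolutely irreducible
representation of dimension n/l over the extension of degree l, and so receives the weight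
q^{-tn+n-l}. In the enlarged sum the field of order p^k is met once for each factorization k = jl.
Together with the lost denominator this costs at most k², which any increase ε of t absorbs
(`irrTotal_lt_top`). Hence it suffices to bound, over each finite field and with constants
independent of it, `absSum` of one group by `irrSum` of another (`logZeta_lt_top_of_absSum_le`).

Such bounds arise by sending a representation to a constituent of a restriction. Fibers and weights
are controlled by one principle: an invariant subspace of a product of pairwise non-isomorphic
irreducibles that projects nontrivially to each factor is everything
(`eq_top_of_pairwise_not_equiv`), with a variant for powers of one irreducible
(`eq_top_of_linearIndependent`).

If W embeds in the restrictions of the V_i to a subgroup of index m, its diagonal image generates ∏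
V_i. Thus ∑ dim V_i ≤ m dim W, and fibers have at most m elements. Likewise l dim V ≤ m dim W if V
has only scalar endomorphisms and End W has degree l, which yields the shift 1 - 1/m. Conversely,
coinduction embeds each W in the top of some V with dim V ≤ m dim W and l dim W ≤ dim V, now with l
the degree of End V, and weights at mt and t are compared. For H × F the constituents over H again
have scalar endomorphisms, so nothing is lost.

In a split extension, V is recorded by a K-constituent W and a quotient U over G/K. The composites W
→ V → U for non-isomorphic V are linearly independent, so at most dim W · dim U representations V
share the same pair. The summand 1 cancels the term dim V in the exponent. Quotients are handled by
inflation, and finite groups by comparison with the trivial group. -/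

open scoped MonoidAlgebra

noncomputable section

namespace Representation

/-! ### Invariant subspaces of products of irreducible representations -/

section Pi

variable {G F ι : Type*} [Group G] [Field F] {V : ι → Type*} [∀ i, AddCommGroup (V i)]
  [∀ i, Module F (V i)]

/-- The product of a family of representations. -/
def piRep (ρ : ∀ i, Representation F G (V i)) : Representation F G (∀ i, V i) where
  toFun g := LinearMap.pi fun i => (ρ i g) ∘ₗ LinearMap.proj i
  map_one' := by ext; simp
  map_mul' g h := by ext; simp

@[simp] lemma piRep_apply (ρ : ∀ i, Representation F G (V i)) (g : G) (x : ∀ i, V i) (i : ι) :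
    piRep ρ g x i = ρ i g (x i) := rfl

lemma piRep_single [DecidableEq ι] (ρ : ∀ i, Representation F G (V i)) (g : G) (i : ι) (v : V i) :
    piRep ρ g (Pi.single i v) = Pi.single i (ρ i g v) := by
  ext j
  rcases eq_or_ne j i with rfl | h
  · simp
  · simp [h]

/-- A proper invariant subspace of a finite product of irreducible representations is killed by
an equivariant map to one of the factors which is the identity on this factor. -/
theorem exists_intertwiningMap_pi [Finite ι] [DecidableEq ι]
    (ρ : ∀ i, Representation F G (V i)) (hρ : ∀ i, (ρ i).IsIrreducible)
    (S : Subrepresentation (piRep ρ)) (hS : S ≠ ⊤) :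
    ∃ (i₀ : ι) (Φ : IntertwiningMap (piRep ρ) (ρ i₀)),
      (∀ x ∈ S, Φ x = 0) ∧ ∀ v, Φ (Pi.single i₀ v) = v := by
  have := Fintype.ofFinite ι
  let P : Finset ι → Subrepresentation (piRep ρ) := fun J =>
    { toSubmodule := Submodule.pi (Jᶜ : Finset ι) (fun _ => ⊥)
      apply_mem_toSubmodule := fun g x hx => by
        simp only [Submodule.mem_pi, Submodule.mem_bot] at hx ⊢
        intro i hi
        simp [hx i hi] }
  have hP : ∀ J x, x ∈ P J ↔ ∀ i, i ∉ J → x i = 0 := by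
    intro J x
    change x ∈ Submodule.pi _ _ ↔ _
    simp [Submodule.mem_pi]
  -- Complement argument from semisimplicity: enlarge S by as many full factors as possible while it
  -- stays proper. Any further factor i₀ then fills the product, so the quotient by T is a copy of
  -- that factor.
  obtain ⟨J, hJ⟩ := Set.Finite.exists_maximal (Set.toFinite {J : Finset ι | S ⊔ P J ≠ ⊤})
    ⟨∅, by
      have : P ∅ = ⊥ := by
        refine le_antisymm (fun x hx => ?_) bot_le
        have := (hP _ _).1 hx
        have : x = 0 := by ext i; exact this i (by simp)
        subst this
        exact (⊥ : Subrepresentation (piRep ρ)).toSubmodule.zero_mem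
      simpa [this] using hS⟩
  set T := S ⊔ P J with hT
  have hTtop : T ≠ ⊤ := hJ.prop
  have hex : ∃ i₀, i₀ ∉ J := by
    by_contra! h
    apply hTtop
    rw [eq_top_iff]
    refine le_trans (fun x _ => ?_) (le_sup_right : P J ≤ T)
    exact (hP _ _).2 fun i hi => absurd (h i) hi
  obtain ⟨i₀, hi₀⟩ := hex
  have hmax : S ⊔ P (insert i₀ J) = ⊤ := by
    by_contra h
    exact hi₀ (hJ.le_of_ge h (Finset.subset_insert _ _) (Finset.mem_insert_self _ _))
  have hgen : ∀ x : ∀ i, V i, ∃ v : V i₀, x - Pi.single i₀ v ∈ T := by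
    intro x
    have hx : x ∈ (S ⊔ P (insert i₀ J)).toSubmodule := by rw [hmax]; trivial
    rw [Subrepresentation.toSubmodule_sup, Submodule.mem_sup] at hx
    obtain ⟨y, hy, z, hz, rfl⟩ := hx
    refine ⟨z i₀, ?_⟩
    rw [add_sub_assoc]
    refine T.toSubmodule.add_mem ((le_sup_left : S ≤ T) hy) ((le_sup_right : P J ≤ T) ?_)
    rw [hP]
    intro i hi
    rcases eq_or_ne i i₀ with rfl | h
    · simp
    · have := (hP _ _).1 hz i (by simp [h, hi])
      simp [h, this]
  -- The part of the factor i₀ lying in T is invariant; were it the whole factor, T would be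
  -- everything.
  let N : Subrepresentation (ρ i₀) :=
    { toSubmodule := T.toSubmodule.comap (LinearMap.single F V i₀)
      apply_mem_toSubmodule := fun g v hv => by
        simp only [Submodule.mem_comap, LinearMap.coe_single] at hv ⊢
        rw [← piRep_single]
        exact T.apply_mem_toSubmodule g hv }
  have hN : N = ⊥ := by
    have := hρ i₀
    refine (eq_bot_or_eq_top N).resolve_right fun h => hTtop ?_
    rw [eq_top_iff]
    intro x _
    obtain ⟨v, hv⟩ := hgen x
    have h2 : v ∈ N := by rw [h]; trivial
    have := T.toSubmodule.add_mem hv (show Pi.single i₀ v ∈ T.toSubmodule from h2)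
    simpa using! this
  let θ : V i₀ →ₗ[F] _ := T.toSubmodule.mkQ ∘ₗ LinearMap.single F V i₀
  have hθ : Function.Bijective θ := by
    constructor
    · rw [← LinearMap.ker_eq_bot, eq_bot_iff]
      intro v hv
      have : v ∈ N := (Submodule.Quotient.mk_eq_zero T.toSubmodule).1 hv
      rw [hN] at this
      exact this
    · intro y
      obtain ⟨x, rfl⟩ := T.toSubmodule.mkQ_surjective y
      obtain ⟨v, hv⟩ := hgen x
      exact ⟨v, ((Submodule.Quotient.eq _).2 hv).symm⟩
  let e := LinearEquiv.ofBijective θ hθ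
  have key : ∀ x v, x - Pi.single i₀ v ∈ T → e.symm (T.toSubmodule.mkQ x) = v := by
    intro x v h
    rw [LinearEquiv.symm_apply_eq]
    exact (Submodule.Quotient.eq _).2 h
  refine ⟨i₀, LinearMap.intertwiningMap_of_isIntertwiningMap _ _
    (e.symm.toLinearMap ∘ₗ T.toSubmodule.mkQ) ?_, ?_, ?_⟩
  · intro g x
    obtain ⟨v, hv⟩ := hgen x
    have h1 := key x v hv
    have h2 := key (piRep ρ g x) (ρ i₀ g v) (by
      rw [← piRep_single, ← map_sub]
      exact T.apply_mem_toSubmodule g hv)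
    simp only [LinearMap.comp_apply, LinearEquiv.coe_coe]
    rw [h1, h2]
  · intro x hx
    exact key x 0 (by simpa using (le_sup_left : S ≤ T) hx)
  · intro v
    exact key _ v (by rw [sub_self]; exact T.toSubmodule.zero_mem)

lemma intertwiningMap_pi_apply [Fintype ι] [DecidableEq ι] {W : Type*} [AddCommGroup W]
    [Module F W] (Φ : (∀ i, V i) →ₗ[F] W) (x : ∀ i, V i) :
    Φ x = ∑ i, Φ (Pi.single i (x i)) := by
  conv_lhs => rw [← Finset.univ_sum_single x]
  simp

/-- An invariant subspace of a finite product of pairwise non-isomorphic irreducible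
representations is everything if it projects nontrivially to all factors. -/
theorem eq_top_of_pairwise_not_equiv [Finite ι]
    (ρ : ∀ i, Representation F G (V i)) (hρ : ∀ i, (ρ i).IsIrreducible)
    (hne : ∀ i j, i ≠ j → IsEmpty (Equiv (ρ i) (ρ j)))
    (S : Subrepresentation (piRep ρ)) (hS : ∀ i, ∃ x ∈ S, x i ≠ 0) : S = ⊤ := by
  classical
  have := Fintype.ofFinite ι
  by_contra h
  obtain ⟨i₀, Φ, h0, h1⟩ := exists_intertwiningMap_pi ρ hρ S h
  obtain ⟨x, hx, hxi⟩ := hS i₀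
  apply hxi
  rw [← h0 x hx]
  change x i₀ = Φ.toLinearMap x
  rw [intertwiningMap_pi_apply, Finset.sum_eq_single i₀]
  · exact (h1 _).symm
  · intro i _ hi
    have := hne i i₀ hi
    have := hρ i
    have := hρ i₀
    -- By Schur's lemma Φ vanishes on all other factors, so Φ is the projection to the factor i₀,
    -- and it kills S.
    let f : IntertwiningMap (ρ i) (ρ i₀) := LinearMap.intertwiningMap_of_isIntertwiningMap _ _
      (Φ.toLinearMap ∘ₗ LinearMap.single F V i) (fun g v => by
        simp [← piRep_single, Φ.isIntertwining])
    have hf : f = 0 := Subsingleton.elim _ _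
    exact congr($hf (x i))
  · simp

end Pi

/-! ### Invariant subspaces of a power of one representation -/

section Isotypic

variable {G F V : Type*} [Group G] [Field F] [AddCommGroup V] [Module F V]

lemma nontrivial_of_isIrreducible {ρ : Representation F G V} (hρ : ρ.IsIrreducible) :
    Nontrivial V := by
  by_contra hV
  have := not_nontrivial_iff_subsingleton.1 hV
  exact bot_ne_top (α := Subrepresentation ρ)
    (Subrepresentation.toSubmodule_injective (Subsingleton.elim _ _))

lemma exists_eq_smul_of_finrank_eq_one {ρ : Representation F G V}
    (h : Module.finrank F (IntertwiningMap ρ ρ) = 1) [Nontrivial V] (φ : IntertwiningMap ρ ρ) :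
    ∃ c : F, ∀ v, φ v = c • v := by
  have h1 : (1 : IntertwiningMap ρ ρ) ≠ 0 := by
    obtain ⟨v, hv⟩ := exists_ne (0 : V)
    intro h
    exact hv congr($h v)
  obtain ⟨c, hc⟩ := (finrank_eq_one_iff_of_nonzero' _ h1).1 h φ
  exact ⟨c, fun v => by rw [← hc]; rfl⟩

/-- If `V` is irreducible with only scalar endomorphisms and the maps `f k : Y → V` are linearly
independent, then no proper invariant subspace of a power of `V` contains all `(f k y)ₖ`. -/
theorem eq_top_of_linearIndependent {ι Y : Type*} [Finite ι] [AddCommGroup Y] [Module F Y]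
    (ρ : Representation F G V) (hρ : ρ.IsIrreducible)
    (h1 : Module.finrank F (IntertwiningMap ρ ρ) = 1) (f : ι → Y →ₗ[F] V)
    (hf : LinearIndependent F f) (S : Subrepresentation (piRep fun _ : ι => ρ))
    (hS : ∀ y, (fun k => f k y) ∈ S) : S = ⊤ := by
  classical
  have := Fintype.ofFinite ι
  by_contra h
  obtain ⟨i₀, Φ, h0, h2⟩ := exists_intertwiningMap_pi (fun _ : ι => ρ) (fun _ => hρ) S h
  have := nontrivial_of_isIrreducible hρ
  let φ : ι → IntertwiningMap ρ ρ := fun i => LinearMap.intertwiningMap_of_isIntertwiningMap _ _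
      (Φ.toLinearMap ∘ₗ LinearMap.single F (fun _ => V) i) (fun g v => by
        have := piRep_single (fun _ : ι => ρ) g i v
        simp [← this, Φ.isIntertwining])
  choose c hc using fun i => exists_eq_smul_of_finrank_eq_one h1 (φ i)
  -- Φ acts on each copy of V by a scalar, so a proper S produces a linear relation among the maps
  -- f, with coefficient 1 at i₀.
  have hsum : ∑ i, c i • f i = 0 := by
    ext y
    have := h0 _ (hS y)
    change Φ.toLinearMap _ = 0 at this
    rw [intertwiningMap_pi_apply] at this
    simp only [LinearMap.sum_apply, LinearMap.smul_apply, LinearMap.zero_apply]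
    rw [← this]
    exact Finset.sum_congr rfl fun i _ => (hc i (f i y)).symm
  have hc0 := Fintype.linearIndependent_iff.1 hf c hsum i₀
  obtain ⟨v, hv⟩ := exists_ne (0 : V)
  apply hv
  have h3 := hc i₀ v
  rw [hc0, zero_smul] at h3
  rw [← h3]
  exact (h2 v).symm

end Isotypic

/-! ### Density: which linear maps come from the group algebra -/

section Density

variable {G F V : Type*} [Group G] [Field F] [AddCommGroup V] [Module F V]

lemma isIrreducible_of_forall {ρ : Representation F G V} [Nontrivial V]
    (h : ∀ S : Subrepresentation ρ, (∃ x ∈ S, x ≠ 0) → ∀ x, x ∈ S) : ρ.IsIrreducible where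
  exists_pair_ne := ⟨⊥, ⊤, fun h => by
    obtain ⟨v, hv⟩ := exists_ne (0 : V)
    have : v ∈ (⊥ : Subrepresentation ρ) := by rw [h]; trivial
    exact hv this⟩
  eq_bot_or_eq_top S := by
    by_cases hS : ∃ x ∈ S, x ≠ 0
    · exact Or.inr (eq_top_iff.2 fun x _ => h S hS x)
    · push Not at hS
      exact Or.inl (eq_bot_iff.2 fun x hx => hS x hx)

/-- Over a finite field, the endomorphisms of an irreducible representation are given by elements
of the group algebra. -/
theorem exists_asAlgebraHom_eq [Finite V] {ρ : Representation F G V} (hρ : ρ.IsIrreducible)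
    (ψ : IntertwiningMap ρ ρ) : ∃ r : F[G], ρ.asAlgebraHom r = ψ.toLinearMap := by
  classical
  have : Finite ρ.asModule := ‹Finite V›
  have : Finite (Module.End F[G] ρ.asModule) := DFunLike.finite _
  let ψ' : Module.End F[G] ρ.asModule := IntertwiningMap.equivAlgEnd ρ ψ
  let f : Module.End (Module.End F[G] ρ.asModule) ρ.asModule :=
    { toFun := ψ'
      map_add' := map_add ψ'
      map_smul' := fun e m => by
        -- The endomorphism ring is a finite division ring, hence commutative, so ψ lies in the
        -- bicommutant of the group algebra.
        have h : ψ' * e = e * ψ' :=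
          (littleWedderburn (Module.End F[G] ρ.asModule)).mul_comm ψ' e
        exact congr($h m) }
  obtain ⟨r, hr⟩ := Module.Finite.toModuleEnd_moduleEnd_surjective (R := F[G])
    (M := ρ.asModule) f
  exact ⟨r, LinearMap.ext fun m => congr($hr m)⟩

/-- The group algebra acts through all linear maps on an irreducible representation with only
scalar endomorphisms. -/
theorem asAlgebraHom_surjective [FiniteDimensional F V] {ρ : Representation F G V}
    (hρ : ρ.IsIrreducible) (h1 : Module.finrank F (IntertwiningMap ρ ρ) = 1) :
    Function.Surjective ρ.asAlgebraHom := by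
  intro a
  have := nontrivial_of_isIrreducible hρ
  have : Module.Finite F ρ.asModule := inferInstance
  have : Module.Finite (Module.End F[G] ρ.asModule) ρ.asModule :=
    Module.Finite.of_restrictScalars_finite F _ _
  let f : Module.End (Module.End F[G] ρ.asModule) ρ.asModule :=
    { toFun := a
      map_add' := map_add a
      map_smul' := fun e m => by
        obtain ⟨c, hc⟩ := exists_eq_smul_of_finrank_eq_one h1
          ((IntertwiningMap.equivAlgEnd ρ).symm e)
        have h2 : ∀ v, e v = (c • (v : V) : V) := hc
        change a (e m) = e (a m)
        exact (congrArg a (h2 m)).trans ((map_smul a c m).trans (h2 (a m)).symm) }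
  obtain ⟨r, hr⟩ := Module.Finite.toModuleEnd_moduleEnd_surjective (R := F[G])
    (M := ρ.asModule) f
  exact ⟨r, LinearMap.ext fun m => congr($hr m)⟩

end Density

end Representation

/-! ### Absolute irreducibility and scalar endomorphisms -/

namespace WeilZeta
open Representation
universe u v
variable {G : Type u} [Group G] {F : Type v} [Field F] {V : Type v} [AddCommGroup V] [Module F V]

lemma extendScalars_tmul (ρ : Representation F G V) (g : G) (c : AlgebraicClosure F) (v : V) :
    extendScalars ρ g (c ⊗ₜ v) = c ⊗ₜ ρ g v := rfl

lemma baseChange_asAlgebraHom_mem (ρ : Representation F G V)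
    (S : Subrepresentation (extendScalars ρ)) (r : F[G]) {x : AlgebraicClosure F ⊗[F] V}
    (hx : x ∈ S) : (ρ.asAlgebraHom r).baseChange (AlgebraicClosure F) x ∈ S := by
  induction r using MonoidAlgebra.induction_linear with
  | zero =>
    rw [map_zero, LinearMap.baseChange_zero]
    exact S.toSubmodule.zero_mem
  | add a b ha hb =>
    rw [map_add, LinearMap.baseChange_add]
    exact S.toSubmodule.add_mem ha hb
  | single g a =>
    rw [asAlgebraHom_single, LinearMap.baseChange_smul]
    have h := S.toSubmodule.smul_mem (algebraMap F (AlgebraicClosure F) a)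
      (S.apply_mem_toSubmodule g hx)
    rw [algebraMap_smul] at h
    exact h

/-- By density F[G] maps onto all of End V. Its base change therefore contains the matrix units, and
these carry any nonzero vector of F̄ ⊗ V to multiples of all basis vectors. -/
theorem isAbsolutelyIrreducible_of_finrank_eq_one [FiniteDimensional F V]
    {ρ : Representation F G V} (hρ : ρ.IsIrreducible)
    (h1 : Module.finrank F (IntertwiningMap ρ ρ) = 1) : IsAbsolutelyIrreducible ρ := by
  refine ⟨hρ, ?_⟩
  have := nontrivial_of_isIrreducible hρ
  let b := Module.finBasis F V
  let B := b.baseChange (AlgebraicClosure F)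
  have hB : ∀ i, B i = 1 ⊗ₜ b i := fun i => by simp [B]
  have : Nontrivial (AlgebraicClosure F ⊗[F] V) := by
    obtain ⟨i⟩ : Nonempty (Fin (Module.finrank F V)) := ⟨⟨0, Module.finrank_pos⟩⟩
    exact ⟨⟨B i, 0, B.ne_zero i⟩⟩
  refine isIrreducible_of_forall ?_
  rintro S ⟨x, hx, hx0⟩ y
  obtain ⟨i, hi⟩ : ∃ i, B.repr x i ≠ 0 := by
    by_contra! h
    exact hx0 (B.repr.map_eq_zero_iff.1 (Finsupp.ext h))
  have hk : ∀ k, B k ∈ S := by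
    intro k
    let a : V →ₗ[F] V := (b.coord i).smulRight (b k)
    obtain ⟨r, hr⟩ := asAlgebraHom_surjective hρ h1 a
    have h2 := baseChange_asAlgebraHom_mem ρ S r hx
    rw [hr] at h2
    have h3 : a.baseChange (AlgebraicClosure F) x = B.repr x i • B k := by
      conv_lhs => rw [← B.sum_repr x]
      rw [map_sum, Finset.sum_eq_single i]
      · simp [hB, a]
      · intro j _ hj
        simp [hB, a, hj]
      · simp
    rw [h3] at h2
    have h4 := S.toSubmodule.smul_mem (B.repr x i)⁻¹ h2
    rwa [smul_smul, inv_mul_cancel₀ hi, one_smul] at h4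
  rw [← B.sum_repr y]
  exact S.toSubmodule.sum_mem fun k _ => S.toSubmodule.smul_mem _ (hk k)

/-- Schur's lemma over F̄ makes the base change of ψ a scalar c. A diagonal matrix entry of ψ equals
c, so c already lies in F. -/
theorem finrank_eq_one_of_isAbsolutelyIrreducible [FiniteDimensional F V]
    {ρ : Representation F G V} (h : IsAbsolutelyIrreducible ρ) :
    Module.finrank F (IntertwiningMap ρ ρ) = 1 := by
  obtain ⟨hρ, h2⟩ := h
  have := nontrivial_of_isIrreducible hρ
  have h1 : (1 : IntertwiningMap ρ ρ) ≠ 0 := by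
    obtain ⟨v, hv⟩ := exists_ne (0 : V)
    intro h
    exact hv congr($h v)
  rw [finrank_eq_one_iff_of_nonzero' _ h1]
  intro ψ
  let b := Module.finBasis F V
  let B := b.baseChange (AlgebraicClosure F)
  have hB : ∀ i, B i = 1 ⊗ₜ b i := fun i => by simp [B]
  let Ψ : IntertwiningMap (extendScalars ρ) (extendScalars ρ) :=
    LinearMap.intertwiningMap_of_isIntertwiningMap _ _
      (ψ.toLinearMap.baseChange (AlgebraicClosure F)) (fun g v => by
        induction v using TensorProduct.induction_on with
        | zero => simp
        | tmul c v => simp [extendScalars_tmul, IntertwiningMap.toLinearMap_apply,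
            ψ.isIntertwining]
        | add x y hx hy => simp only [map_add, hx, hy])
  obtain ⟨c, hc⟩ :=
    (IsIrreducible.algebraMap_intertwiningMap_bijective_of_isAlgClosed
      (ρ := extendScalars ρ)).2 Ψ
  have hcv : ∀ v : V, (1 : AlgebraicClosure F) ⊗ₜ[F] ψ v = c ⊗ₜ v := by
    intro v
    have := congr($hc (1 ⊗ₜ v))
    rw [IntertwiningMap.algebraMap_apply, IntertwiningMap.smul_apply] at this
    simpa [TensorProduct.smul_tmul', Ψ] using! this.symm
  let i : Fin (Module.finrank F V) := ⟨0, Module.finrank_pos⟩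
  have hci : algebraMap F (AlgebraicClosure F) (b.repr (ψ (b i)) i) = c := by
    have := congr(B.repr $(hcv (b i)) i)
    simpa [B, Algebra.smul_def] using this
  refine ⟨b.repr (ψ (b i)) i, ?_⟩
  ext v
  apply Module.FaithfullyFlat.tensorProduct_mk_injective (A := F) (B := AlgebraicClosure F) V
  change (1 : AlgebraicClosure F) ⊗ₜ[F] (b.repr (ψ (b i)) i • v) = 1 ⊗ₜ ψ v
  rw [hcv, ← hci, ← TensorProduct.smul_tmul, Algebra.smul_def, mul_one]

/-! ### Restriction of scalars from the endomorphism field -/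

section Restrict

variable {G : Type u} [Group G] {F : Type v} [Field F] {V : Type v} [AddCommGroup V] [Module F V]

/-- An extension of a finite field whose degree is the dimension of the endomorphism algebra of
an irreducible representation acts on the representation as this endomorphism algebra. -/
theorem exists_algHom_end [Finite F] [FiniteDimensional F V] {ρ : Representation F G V}
    (hρ : ρ.IsIrreducible) {L : Type v} [Field L] [Algebra F L]
    (hL : Module.finrank F L = Module.finrank F (IntertwiningMap ρ ρ)) :
    ∃ β : L →ₐ[F] Module.End F V, (∀ c g v, β c (ρ g v) = ρ g (β c v)) ∧
      ∀ ψ : IntertwiningMap ρ ρ, ∃ c, β c = ψ.toLinearMap := by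
  classical
  have := nontrivial_of_isIrreducible hρ
  have : Finite V := Module.finite_of_finite F
  have : Finite ρ.asModule := ‹Finite V›
  have : Finite (Module.End F[G] ρ.asModule) := DFunLike.finite _
  let E := Module.End F[G] ρ.asModule
  let _ : Field E := littleWedderburn E
  have hE : Module.finrank F L = Module.finrank F E :=
    hL.trans (IntertwiningMap.equivAlgEnd ρ).toLinearEquiv.finrank_eq
  have : Finite E := ‹_›
  have : Module.Finite F E := Module.Finite.of_finite
  have hpos : 0 < Module.finrank F E := Module.finrank_pos
  have : NeZero (Module.finrank F E) := ⟨hpos.ne'⟩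
  obtain ⟨p, _⟩ := CharP.exists F
  have : Fact p.Prime := ⟨CharP.char_is_prime F p⟩
  -- Extensions of a finite field of equal degree are isomorphic over it, so L may replace the
  -- endomorphism field.
  let α : L ≃ₐ[F] E := (FiniteField.algEquivExtension F p _ L hE).trans
    (FiniteField.algEquivExtension F p _ E rfl).symm
  let γ : L ≃ₐ[F] IntertwiningMap ρ ρ := α.trans (IntertwiningMap.equivAlgEnd ρ).symm
  let τ : IntertwiningMap ρ ρ →ₐ[F] Module.End F V :=
    AlgHom.ofLinearMap (IntertwiningMap.toLinearMapl ρ ρ) rfl (fun _ _ => rfl)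
  refine ⟨τ.comp γ.toAlgHom, fun c g v => IntertwiningMap.isIntertwining _ _ (γ c) g v,
    fun ψ => ⟨γ.symm ψ, ?_⟩⟩
  exact congrArg τ (γ.apply_symm_apply ψ)

/-- An irreducible representation over a finite field is obtained by restriction of scalars from
an absolutely irreducible representation. -/
theorem exists_isAbsolutelyIrreducible_restrictScalars [Finite F] [FiniteDimensional F V]
    {ρ : Representation F G V}
    (hρ : ρ.IsIrreducible) {L : Type v} [Field L] [Algebra F L]
    (hL : Module.finrank F L = Module.finrank F (IntertwiningMap ρ ρ)) :
    ∃ (d : ℕ) (σ : Representation L G (Fin d → L)) (e : V ≃+ (Fin d → L)),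
      (∀ (c : F) v, e (c • v) = algebraMap F L c • e v) ∧
      (∀ g v, e (ρ g v) = σ g (e v)) ∧ IsAbsolutelyIrreducible σ ∧
      Module.finrank F (IntertwiningMap ρ ρ) * d = Module.finrank F V := by
  obtain ⟨β, hβ, hβ'⟩ := exists_algHom_end hρ hL
  have := nontrivial_of_isIrreducible hρ
  let _ : Module L V := Module.compHom V β.toRingHom
  have hsmul : ∀ (c : L) (v : V), c • v = β c v := fun _ _ => rfl
  have : IsScalarTower F L V := IsScalarTower.of_algebraMap_smul fun c v => by
    rw [hsmul, AlgHom.commutes]; rfl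
  have hone : (1 : IntertwiningMap ρ ρ) ≠ 0 := by
    obtain ⟨v, hv⟩ := exists_ne (0 : V)
    intro h
    exact hv congr($h v)
  have : Nontrivial (IntertwiningMap ρ ρ) := ⟨⟨_, _, hone⟩⟩
  have : Module.Finite F L := Module.finite_of_finrank_pos (hL ▸ Module.finrank_pos)
  have : Module.Finite L V := Module.Finite.of_restrictScalars_finite F L V
  let e : V ≃ₗ[L] (Fin (Module.finrank L V) → L) := (Module.finBasis L V).equivFun
  let σ' : Representation L G V :=
    { toFun := fun g => { toFun := ρ g, map_add' := map_add _, map_smul' := fun c v =>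
        (hβ c g v).symm }
      map_one' := by ext; simp
      map_mul' := fun _ _ => by ext; simp }
  have hσ' : ∀ g v, σ' g v = ρ g v := fun _ _ => rfl
  let σ : Representation L G (Fin (Module.finrank L V) → L) :=
    (e.conjRingEquiv : _ →* _).comp σ'
  have hσ : ∀ g v, e (ρ g v) = σ g (e v) := fun g v => by simp [σ, hσ']
  have hσ2 : ∀ g w, e.symm (σ g w) = ρ g (e.symm w) := fun g w => by
    rw [LinearEquiv.symm_apply_eq, hσ, e.apply_symm_apply]
  have : Nontrivial (Fin (Module.finrank L V) → L) := e.symm.toEquiv.nontrivial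
  have hirr : σ.IsIrreducible := by
    refine isIrreducible_of_forall ?_
    rintro S ⟨x, hx, hx0⟩ y
    let S' : Subrepresentation ρ :=
      { toSubmodule := (S.toSubmodule.comap e.toLinearMap).restrictScalars F
        apply_mem_toSubmodule := fun g v hv => by
          simp only [Submodule.restrictScalars_mem, Submodule.mem_comap,
            LinearEquiv.coe_coe] at hv ⊢
          rw [hσ]
          exact S.apply_mem_toSubmodule g hv }
    have hmem : ∀ w, w ∈ S ↔ e.symm w ∈ S' := fun w => by
      change _ ↔ e (e.symm w) ∈ S
      rw [e.apply_symm_apply]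
    have : S' = ⊤ := (eq_bot_or_eq_top S').resolve_left fun h => hx0 (by
      have h2 := (hmem x).1 hx
      rw [h] at h2
      exact e.symm.map_eq_zero_iff.1 h2)
    rw [hmem, this]
    trivial
  refine ⟨_, σ, e.toAddEquiv, fun c v => ?_, hσ, ?_, ?_⟩
  · change e (c • v) = _
    rw [← algebraMap_smul L c v]
    exact map_smul e _ _
  · refine isAbsolutelyIrreducible_of_finrank_eq_one hirr ?_
    have h1 : (1 : IntertwiningMap σ σ) ≠ 0 := by
      obtain ⟨v, hv⟩ := exists_ne (0 : Fin (Module.finrank L V) → L)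
      intro h
      exact hv congr($h v)
    rw [finrank_eq_one_iff_of_nonzero' _ h1]
    intro ψ
    -- An L-linear endomorphism is also F-linear, hence multiplication by an element of L. This is
    -- why the L-structure leaves only scalars.
    let ψ' : IntertwiningMap ρ ρ := LinearMap.intertwiningMap_of_isIntertwiningMap _ _
      ((e.symm.toLinearMap ∘ₗ ψ.toLinearMap ∘ₗ e.toLinearMap).restrictScalars F) (fun g v => by
        simp [hσ, ψ.isIntertwining, hσ2])
    obtain ⟨c, hc⟩ := hβ' ψ'
    refine ⟨c, ?_⟩
    ext1
    refine LinearMap.ext fun w => ?_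
    have := congr($hc (e.symm w))
    rw [← hsmul] at this
    have h2 := congrArg e this
    rw [map_smul, e.apply_symm_apply] at h2
    refine h2.trans ?_
    change e (e.symm (ψ (e (e.symm w)))) = _
    rw [e.apply_symm_apply, e.apply_symm_apply]
    rfl
  · rw [← hL]
    exact Module.finrank_mul_finrank F L V

end Restrict

end WeilZeta

namespace Representation

/-! ### Irreducible subrepresentations and quotients -/

section Existence

variable {G F X Y : Type*} [Group G] [Field F] [AddCommGroup X] [Module F X]
  [AddCommGroup Y] [Module F Y]

lemma mem_bot_iff {ρ : Representation F G X} {x : X} :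
    x ∈ (⊥ : Subrepresentation ρ) ↔ x = 0 := Iff.rfl

lemma isIrreducible_of_equiv {ρ : Representation F G X} {τ : Representation F G Y}
    (e : Equiv ρ τ) (hρ : ρ.IsIrreducible) : τ.IsIrreducible := by
  have := nontrivial_of_isIrreducible hρ
  have : Nontrivial Y := e.toLinearEquiv.symm.toEquiv.nontrivial
  refine isIrreducible_of_forall ?_
  rintro S ⟨x, hx, hx0⟩ y
  let S' : Subrepresentation ρ :=
    { toSubmodule := S.toSubmodule.comap e.toLinearMap
      apply_mem_toSubmodule := fun g v hv => by
        have h1 : e (ρ g v) = τ g (e v) := IntertwiningMap.isIntertwining _ _ e.toIntertwiningMap g v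
        change e (ρ g v) ∈ S
        rw [h1]
        exact S.apply_mem_toSubmodule g hv }
  have hmem : ∀ w, w ∈ S ↔ e.symm w ∈ S' := fun w => by
    change _ ↔ e (e.symm w) ∈ S
    rw [e.apply_symm_apply]
  have : S' = ⊤ := (eq_bot_or_eq_top S').resolve_left fun h => hx0 (by
    have h2 := (hmem x).1 hx
    rw [h, mem_bot_iff] at h2
    rw [← e.apply_symm_apply x, h2]
    exact map_zero e.toLinearEquiv)
  rw [hmem, this]
  trivial

lemma exists_equiv_fin [FiniteDimensional F X] (ρ : Representation F G X) :
    ∃ (n : ℕ) (τ : Representation F G (Fin n → F)), Nonempty (Equiv ρ τ) := by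
  let e := (Module.finBasis F X).equivFun
  exact ⟨_, (e.conjRingEquiv : _ →* _).comp ρ, ⟨Equiv.mk e fun g => by ext; simp⟩⟩

/-- A nonzero finite-dimensional representation contains an irreducible one. -/
theorem exists_irreducible_sub [FiniteDimensional F X] [Nontrivial X]
    (ρ : Representation F G X) :
    ∃ (n : ℕ) (τ : Representation F G (Fin n → F)) (f : IntertwiningMap τ ρ),
      τ.IsIrreducible ∧ Function.Injective f := by
  obtain ⟨S, hS, hmin⟩ := (measure fun S : Subrepresentation ρ =>
    Module.finrank F S.toSubmodule).wf.has_min {S | S ≠ ⊥} ⟨⊤, fun h => by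
      obtain ⟨v, hv⟩ := exists_ne (0 : X)
      have : v ∈ (⊥ : Subrepresentation ρ) := by rw [← h]; trivial
      exact hv this⟩
  have hnt : Nontrivial S.toSubmodule := by
    rw [Submodule.nontrivial_iff_ne_bot]
    exact fun h => hS (Subrepresentation.toSubmodule_injective h)
  have hirr : S.toRepresentation.IsIrreducible := by
    refine isIrreducible_of_forall ?_
    rintro T ⟨x, hx, hx0⟩ y
    let T' : Subrepresentation ρ :=
      { toSubmodule := T.toSubmodule.map S.toSubmodule.subtype
        apply_mem_toSubmodule := by
          rintro g _ ⟨v, hv, rfl⟩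
          exact ⟨_, T.apply_mem_toSubmodule g hv, rfl⟩ }
    have hle : T'.toSubmodule ≤ S.toSubmodule := Submodule.map_subtype_le _ _
    have hT' : T' ≠ ⊥ := fun h => hx0 (by
      have : (x : X) ∈ T' := ⟨x, hx, rfl⟩
      rw [h, mem_bot_iff] at this
      exact Subtype.ext this)
    have heq := Submodule.eq_of_le_of_finrank_le hle (not_lt.1 (hmin T' hT'))
    have hy : (y : X) ∈ T'.toSubmodule := by rw [heq]; exact y.2
    obtain ⟨z, hz, hzy⟩ := hy
    have : z = y := Subtype.ext hzy
    rwa [← this]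
  obtain ⟨n, τ, ⟨e⟩⟩ := exists_equiv_fin S.toRepresentation
  let i : IntertwiningMap S.toRepresentation ρ :=
    LinearMap.intertwiningMap_of_isIntertwiningMap _ _ S.toSubmodule.subtype fun _ _ => rfl
  refine ⟨n, τ, i.comp e.symm.toIntertwiningMap, isIrreducible_of_equiv e hirr, ?_⟩
  exact Subtype.val_injective.comp e.toLinearEquiv.symm.injective

/-- A nonzero finite-dimensional representation has an irreducible quotient. -/
theorem exists_irreducible_quotient [FiniteDimensional F X] [Nontrivial X]
    (ρ : Representation F G X) :
    ∃ (n : ℕ) (τ : Representation F G (Fin n → F)) (p : IntertwiningMap ρ τ),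
      τ.IsIrreducible ∧ Function.Surjective p := by
  obtain ⟨S, hS, hmin⟩ := (measure fun S : Subrepresentation ρ =>
    Module.finrank F X - Module.finrank F S.toSubmodule).wf.has_min {S | S ≠ ⊤} ⟨⊥, fun h => by
      obtain ⟨v, hv⟩ := exists_ne (0 : X)
      have : v ∈ (⊥ : Subrepresentation ρ) := by rw [h]; trivial
      exact hv this⟩
  have hnt : Nontrivial (X ⧸ S.toSubmodule) := by
    rw [Submodule.Quotient.nontrivial_iff]
    exact fun h => hS (Subrepresentation.toSubmodule_injective h)
  let τ' := ρ.quotient S.toSubmodule (fun g v hv => S.apply_mem_toSubmodule g hv)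
  let q : IntertwiningMap ρ τ' :=
    LinearMap.intertwiningMap_of_isIntertwiningMap _ _ S.toSubmodule.mkQ fun _ _ => rfl
  have hirr : τ'.IsIrreducible := by
    refine isIrreducible_of_forall ?_
    rintro T ⟨x, hx, hx0⟩ y
    let T' : Subrepresentation ρ :=
      { toSubmodule := T.toSubmodule.comap S.toSubmodule.mkQ
        apply_mem_toSubmodule := fun g v hv => T.apply_mem_toSubmodule g hv }
    have hle : S.toSubmodule ≤ T'.toSubmodule := fun v hv => by
      change S.toSubmodule.mkQ v ∈ T.toSubmodule
      rw [Submodule.mkQ_apply, (Submodule.Quotient.mk_eq_zero _).2 hv]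
      exact T.toSubmodule.zero_mem
    have hT' : T' = ⊤ := by
      by_contra h
      have h1 : ¬ (Module.finrank F X - Module.finrank F T'.toSubmodule <
          Module.finrank F X - Module.finrank F S.toSubmodule) := hmin T' h
      have h2 := Submodule.finrank_le T'.toSubmodule
      have h4 := Submodule.finrank_le S.toSubmodule
      have h3 := Submodule.eq_of_le_of_finrank_le hle (by omega)
      obtain ⟨z, rfl⟩ := S.toSubmodule.mkQ_surjective x
      apply hx0
      have : z ∈ T'.toSubmodule := hx
      rw [← h3] at this
      exact (Submodule.Quotient.mk_eq_zero _).2 this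
    obtain ⟨z, rfl⟩ := S.toSubmodule.mkQ_surjective y
    have : z ∈ T' := by rw [hT']; trivial
    exact this
  obtain ⟨n, τ, ⟨e⟩⟩ := exists_equiv_fin τ'
  refine ⟨n, τ, e.toIntertwiningMap.comp q, isIrreducible_of_equiv e hirr, ?_⟩
  exact e.toLinearEquiv.surjective.comp S.toSubmodule.mkQ_surjective

end Existence

/-! ### Dimension of the subrepresentation generated by a subspace -/

section Orbit

variable {G H F X Y : Type*} [Group G] [Group H] [Field F] [AddCommGroup X] [Module F X]
  [AddCommGroup Y] [Module F Y]

/-- The subrepresentation generated by a subspace. -/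
def orbitSpan (ρ : Representation F G X) (D : Submodule F X) : Subrepresentation ρ where
  toSubmodule := ⨆ g, D.map (ρ g)
  apply_mem_toSubmodule g v hv := by
    suffices (⨆ g, D.map (ρ g)) ≤ (⨆ g, D.map (ρ g)).comap (ρ g) from this hv
    refine iSup_le fun k => ?_
    rintro _ ⟨x, hx, rfl⟩
    refine Submodule.mem_iSup_of_mem (g * k) ⟨x, hx, ?_⟩
    simp

lemma mem_orbitSpan_of_mem (ρ : Representation F G X) {D : Submodule F X} {x : X} (hx : x ∈ D) :
    x ∈ orbitSpan ρ D :=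
  Submodule.mem_iSup_of_mem 1 ⟨x, hx, by simp⟩

lemma orbitSpan_le (ρ : Representation F G X) {D p : Submodule F X}
    (h : ∀ g, ∀ x ∈ D, ρ g x ∈ p) : (orbitSpan ρ D).toSubmodule ≤ p :=
  iSup_le fun g => by
    rintro _ ⟨x, hx, rfl⟩
    exact h g x hx

/-- The subrepresentation of `G` generated by a subspace which is stable under a subgroup with
at most `R.card` cosets. -/
theorem finrank_orbitSpan_le (ρ : Representation F G X) (φ : H →* G) (R : Finset G)
    (hR : ∀ g, ∃ r ∈ R, ∃ h, g = r * φ h) (D : Submodule F X) [FiniteDimensional F D]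
    (hD : ∀ h, ∀ x ∈ D, ρ (φ h) x ∈ D) :
    FiniteDimensional F (orbitSpan ρ D).toSubmodule ∧
      Module.finrank F (orbitSpan ρ D).toSubmodule ≤ R.card * Module.finrank F D := by
  classical
  let T : (R → D) →ₗ[F] X := LinearMap.lsum F (fun _ : R => D) F
    (fun r => (ρ r) ∘ₗ D.subtype)
  have hle : (orbitSpan ρ D).toSubmodule ≤ LinearMap.range T := by
    refine orbitSpan_le ρ fun g x hx => ?_
    obtain ⟨r, hr, h, rfl⟩ := hR g
    refine ⟨Pi.single ⟨r, hr⟩ ⟨ρ (φ h) x, hD h x hx⟩, ?_⟩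
    simp only [T, LinearMap.lsum_apply, LinearMap.sum_apply]
    rw [Finset.sum_eq_single ⟨r, hr⟩]
    · simp
    · intro b _ hb
      simp [hb]
    · simp
  refine ⟨Submodule.finiteDimensional_of_le hle, ?_⟩
  calc Module.finrank F (orbitSpan ρ D).toSubmodule ≤ Module.finrank F (LinearMap.range T) :=
        Submodule.finrank_mono hle
    _ ≤ Module.finrank F (R → D) := LinearMap.finrank_range_le T
    _ = R.card * Module.finrank F D := by simp [Module.finrank_pi_fintype]

/-- The image of Y is stable under H, so its translates by R already span the subrepresentation it
generates. Every dimension bound for restriction to a subgroup is an instance, with X a product. -/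
lemma finrank_le_of_map_mem [FiniteDimensional F X] [FiniteDimensional F Y]
    (ρ : Representation F G X) (φ : H →* G) (R : Finset G)
    (hR : ∀ g, ∃ r ∈ R, ∃ h, g = r * φ h) (σ : Representation F H Y)
    (f : IntertwiningMap σ (ρ.comp φ))
    (htop : ∀ S : Subrepresentation ρ, (∀ y, f y ∈ S) → S = ⊤) :
    Module.finrank F X ≤ R.card * Module.finrank F Y := by
  have h1 := (finrank_orbitSpan_le ρ φ R hR (LinearMap.range f.toLinearMap) (by
    rintro h _ ⟨y, rfl⟩
    exact ⟨σ h y, f.isIntertwining _ _ h y⟩)).2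
  have h2 := htop (orbitSpan ρ (LinearMap.range f.toLinearMap)) fun y =>
    mem_orbitSpan_of_mem ρ ⟨y, rfl⟩
  rw [h2] at h1
  have h3 : Module.finrank F (⊤ : Subrepresentation ρ).toSubmodule = Module.finrank F X :=
    finrank_top F X
  rw [h3] at h1
  exact h1.trans (Nat.mul_le_mul_left _ (LinearMap.finrank_range_le _))

end Orbit

section Basic

variable {H F V W : Type*} [Group H] [Field F] [AddCommGroup V] [Module F V]
  [AddCommGroup W] [Module F W] {τ : Representation F H V} {σ : Representation F H W}

lemma injective_of_ne_zero (hσ : σ.IsIrreducible)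
    (f : IntertwiningMap σ τ) (hf : f ≠ 0) : Function.Injective f := by
  have := hσ
  exact (IsIrreducible.injective_or_eq_zero f).resolve_right hf

lemma surjective_of_ne_zero (hσ : σ.IsIrreducible)
    (f : IntertwiningMap τ σ) (hf : f ≠ 0) : Function.Surjective f := by
  have := hσ
  exact (IsIrreducible.surjective_or_eq_zero f).resolve_right hf

lemma ne_zero_of_apply_ne_zero (f : IntertwiningMap σ τ) {w : W}
    (h : f w ≠ 0) : f ≠ 0 := by
  rintro rfl
  exact h rfl

lemma exists_apply_ne_zero {f : IntertwiningMap σ τ} (h : f ≠ 0) :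
    ∃ w, f w ≠ 0 := by
  by_contra! h'
  exact h (IntertwiningMap.ext (LinearMap.ext h'))

lemma finrank_le_of_intertwiningMap [FiniteDimensional F V] (hσ : σ.IsIrreducible)
    (f : IntertwiningMap σ τ) (hf : f ≠ 0) : Module.finrank F W ≤ Module.finrank F V :=
  LinearMap.finrank_le_finrank_of_injective (f := f.toLinearMap) (injective_of_ne_zero hσ f hf)

end Basic

/-! ### Restriction along a homomorphism: dimensions, degrees, multiplicities -/

section Compare

variable {G H F V W : Type*} [Group G] [Group H] [Field F] [AddCommGroup V] [Module F V]
  [AddCommGroup W] [Module F W] [FiniteDimensional F W]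
  {ρ : Representation F G V} {σ : Representation F H W} {φ : H →* G}

/-- Composing f with a basis of End σ gives independent maps W → V, since f is injective. Together
they embed W diagonally in a power of V, which it must generate. -/
theorem finrank_end_mul_le_of_sub [FiniteDimensional F V] (hρ : ρ.IsIrreducible)
    (h1 : Module.finrank F (IntertwiningMap ρ ρ) = 1) (hσ : σ.IsIrreducible)
    (f : IntertwiningMap σ (ρ.comp φ)) (hf : f ≠ 0) (R : Finset G)
    (hR : ∀ g, ∃ r ∈ R, ∃ h, g = r * φ h) :
    Module.finrank F (IntertwiningMap σ σ) * Module.finrank F V ≤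
      R.card * Module.finrank F W := by
  let b := Module.finBasis F (IntertwiningMap σ σ)
  let fk : Fin (Module.finrank F (IntertwiningMap σ σ)) → W →ₗ[F] V := fun k =>
    f.toLinearMap ∘ₗ (b k).toLinearMap
  have hlin : LinearIndependent F fk := by
    rw [Fintype.linearIndependent_iff]
    intro c hc
    have h0 : ∑ k, c k • b k = 0 := by
      refine IntertwiningMap.ext (LinearMap.ext fun w => injective_of_ne_zero hσ f hf ?_)
      have h2 := congr($hc w)
      simp only [LinearMap.sum_apply, LinearMap.smul_apply, LinearMap.comp_apply, fk] at h2
      rw [IntertwiningMap.toLinearMap_sum, LinearMap.sum_apply]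
      change f.toLinearMap _ = f.toLinearMap _
      rw [map_sum]
      simpa using h2
    exact Fintype.linearIndependent_iff.1 b.linearIndependent c h0
  let D : IntertwiningMap σ ((piRep fun _ : Fin (Module.finrank F (IntertwiningMap σ σ)) =>
      ρ).comp φ) := LinearMap.intertwiningMap_of_isIntertwiningMap _ _ (LinearMap.pi fk)
    (fun h w => by
      ext k
      change f (b k (σ h w)) = ρ (φ h) (f (b k w))
      rw [(b k).isIntertwining, f.isIntertwining]
      rfl)
  have := finrank_le_of_map_mem _ φ R hR σ D
    (fun S hS => eq_top_of_linearIndependent ρ hρ h1 fk hlin S hS)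
  simpa [Module.finrank_pi_fintype] using this

/-- Dual argument: composing a basis of End ρ with p gives independent maps V → W, because nonzero
endomorphisms of V are surjective. So V maps onto a power of W. -/
theorem finrank_end_mul_le_of_quotient [FiniteDimensional F V] (hρ : ρ.IsIrreducible)
    (hσ : σ.IsIrreducible)
    (h1 : Module.finrank F (IntertwiningMap σ σ) = 1)
    (p : IntertwiningMap (ρ.comp φ) σ) (hp : p ≠ 0) :
    Module.finrank F (IntertwiningMap ρ ρ) * Module.finrank F W ≤ Module.finrank F V := by
  let b := Module.finBasis F (IntertwiningMap ρ ρ)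
  let pk : Fin (Module.finrank F (IntertwiningMap ρ ρ)) → V →ₗ[F] W := fun k =>
    p.toLinearMap ∘ₗ (b k).toLinearMap
  have hlin : LinearIndependent F pk := by
    rw [Fintype.linearIndependent_iff]
    intro c hc
    have h0 : ∑ k, c k • b k = 0 := by
      by_contra hne
      have hs := surjective_of_ne_zero hρ _ hne
      obtain ⟨v, hv⟩ := exists_apply_ne_zero hp
      obtain ⟨w, rfl⟩ := hs v
      apply hv
      have h2 := congr($hc w)
      simp only [LinearMap.sum_apply, LinearMap.smul_apply, LinearMap.comp_apply, pk] at h2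
      rw [IntertwiningMap.sum_apply]
      change p.toLinearMap _ = 0
      rw [map_sum]
      refine (Finset.sum_congr rfl fun k _ => ?_).trans h2
      exact map_smul p.toLinearMap (c k) (b k w)
    exact Fintype.linearIndependent_iff.1 b.linearIndependent c h0
  let D : IntertwiningMap (ρ.comp φ)
      (piRep fun _ : Fin (Module.finrank F (IntertwiningMap ρ ρ)) => σ) :=
    LinearMap.intertwiningMap_of_isIntertwiningMap _ _ (LinearMap.pi pk)
    (fun h w => by
      ext k
      change p (b k (ρ (φ h) w)) = σ h (p (b k w))
      rw [(b k).isIntertwining, ← p.isIntertwining]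
      rfl)
  have htop := eq_top_of_linearIndependent σ hσ h1 pk hlin D.range fun y => ⟨y, rfl⟩
  have hsurj : Function.Surjective D.toLinearMap := fun x => by
    have : x ∈ D.range := by rw [htop]; trivial
    exact this
  have := LinearMap.finrank_le_finrank_of_surjective hsurj
  simpa [Module.finrank_pi_fintype] using this

/-- The diagonal image of W meets every factor nontrivially, hence generates the whole product. -/
theorem sum_finrank_le_of_sub {ι : Type*} [Fintype ι] {V : ι → Type*} [∀ i, AddCommGroup (V i)]
    [∀ i, Module F (V i)] [∀ i, FiniteDimensional F (V i)]
    (ρ : ∀ i, Representation F G (V i)) (hρ : ∀ i, (ρ i).IsIrreducible)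
    (hne : ∀ i j, i ≠ j → IsEmpty (Equiv (ρ i) (ρ j)))
    (f : ∀ i, IntertwiningMap σ ((ρ i).comp φ)) (hf : ∀ i, f i ≠ 0) (R : Finset G)
    (hR : ∀ g, ∃ r ∈ R, ∃ h, g = r * φ h) :
    ∑ i, Module.finrank F (V i) ≤ R.card * Module.finrank F W := by
  let D : IntertwiningMap σ ((piRep ρ).comp φ) :=
    LinearMap.intertwiningMap_of_isIntertwiningMap _ _ (LinearMap.pi fun i => (f i).toLinearMap)
    (fun h w => by
      ext k
      exact (f k).isIntertwining _ _ h w)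
  have := finrank_le_of_map_mem _ φ R hR σ D
    (fun S hS => eq_top_of_pairwise_not_equiv ρ hρ hne S fun i => by
      obtain ⟨w, hw⟩ := exists_apply_ne_zero (hf i)
      exact ⟨_, hS w, hw⟩)
  simpa [Module.finrank_pi_fintype] using this

theorem sum_finrank_le_of_quotient [FiniteDimensional F V] {ι : Type*} [Fintype ι]
    {W : ι → Type*} [∀ i, AddCommGroup (W i)] [∀ i, Module F (W i)] [∀ i, FiniteDimensional F (W i)]
    (σ : ∀ i, Representation F H (W i)) (hσ : ∀ i, (σ i).IsIrreducible)
    (hne : ∀ i j, i ≠ j → IsEmpty (Equiv (σ i) (σ j)))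
    (p : ∀ i, IntertwiningMap (ρ.comp φ) (σ i)) (hp : ∀ i, p i ≠ 0) :
    ∑ i, Module.finrank F (W i) ≤ Module.finrank F V := by
  let D : IntertwiningMap (ρ.comp φ) (piRep σ) :=
    LinearMap.intertwiningMap_of_isIntertwiningMap _ _ (LinearMap.pi fun i => (p i).toLinearMap)
    (fun h w => by
      ext k
      exact (p k).isIntertwining _ _ h w)
  have htop := eq_top_of_pairwise_not_equiv σ hσ hne D.range fun i => by
    obtain ⟨v, hv⟩ := exists_apply_ne_zero (hp i)
    exact ⟨_, ⟨v, rfl⟩, hv⟩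
  have hsurj : Function.Surjective D.toLinearMap := fun x => by
    have : x ∈ D.range := by rw [htop]; trivial
    exact this
  have := LinearMap.finrank_le_finrank_of_surjective hsurj
  simpa [Module.finrank_pi_fintype] using this

/-- If `G` is generated by the image of `H` and by a set of elements commuting with this image,
then the irreducible constituents over `H` of a representation with only scalar endomorphisms
have only scalar endomorphisms, too. -/
theorem finrank_end_eq_one_of_commute [Finite F] (hρ : ρ.IsIrreducible)
    (h1 : Module.finrank F (IntertwiningMap ρ ρ) = 1) (hσ : σ.IsIrreducible)
    (f : IntertwiningMap σ (ρ.comp φ)) (hf : f ≠ 0) (R : Set G)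
    (hR : ∀ g, ∃ r ∈ R, ∃ h, g = r * φ h) (hcomm : ∀ r ∈ R, ∀ h, r * φ h = φ h * r) :
    Module.finrank F (IntertwiningMap σ σ) = 1 := by
  have := nontrivial_of_isIrreducible hσ
  have := nontrivial_of_isIrreducible hρ
  have : Finite W := Module.finite_of_finite F
  have hone : (1 : IntertwiningMap σ σ) ≠ 0 := by
    obtain ⟨v, hv⟩ := exists_ne (0 : W)
    exact ne_zero_of_apply_ne_zero _ hv
  rw [finrank_eq_one_iff_of_nonzero' _ hone]
  intro ψ
  obtain ⟨r, hr⟩ := exists_asAlgebraHom_eq hσ ψ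
  -- Writing ψ as a group algebra element r lets it act on all of V. Since R commutes with the image
  -- of H, this action A turns out to be G-equivariant, hence scalar, and it restricts to ψ on W.
  let A : V →ₗ[F] V := asAlgebraHom (ρ.comp φ) r
  have hfr : ∀ (s : F[H]) w, asAlgebraHom (ρ.comp φ) s (f w) = f (σ.asAlgebraHom s w) := by
    intro s w
    induction s using MonoidAlgebra.induction_linear with
    | zero => simp
    | add a b ha hb =>
      rw [map_add, map_add, LinearMap.add_apply, LinearMap.add_apply, ha, hb]
      exact (map_add f.toLinearMap _ _).symm
    | single h a =>
      rw [asAlgebraHom_single, asAlgebraHom_single, LinearMap.smul_apply, LinearMap.smul_apply,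
        ← f.isIntertwining]
      exact (map_smul f.toLinearMap _ _).symm
  have hcommA : ∀ (s : F[H]), ∀ x ∈ R, ∀ v,
      asAlgebraHom (ρ.comp φ) s (ρ x v) = ρ x (asAlgebraHom (ρ.comp φ) s v) := by
    intro s x hx v
    induction s using MonoidAlgebra.induction_linear with
    | zero => simp
    | add a b ha hb => simp only [map_add, LinearMap.add_apply, ha, hb]
    | single h a =>
      simp only [asAlgebraHom_single, LinearMap.smul_apply, map_smul, MonoidHom.comp_apply]
      rw [← Module.End.mul_apply, ← Module.End.mul_apply, ← map_mul, ← map_mul, hcomm x hx]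
  have hAf : ∀ w, A (f w) = f (ψ w) := fun w => by
    rw [hfr, hr]; rfl
  have hspan : ∀ v : V, v ∈ Submodule.span F {v | ∃ x ∈ R, ∃ w, v = ρ x (f w)} := by
    have htop : orbitSpan ρ (LinearMap.range f.toLinearMap) = ⊤ := by
      refine (hρ.eq_bot_or_eq_top _).resolve_left fun h => ?_
      obtain ⟨w, hw⟩ := exists_apply_ne_zero hf
      have : f w ∈ orbitSpan ρ (LinearMap.range f.toLinearMap) :=
        mem_orbitSpan_of_mem ρ ⟨w, rfl⟩
      rw [h] at this
      exact hw this
    intro v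
    refine orbitSpan_le ρ ?_ (show v ∈ (orbitSpan ρ (LinearMap.range f.toLinearMap)).toSubmodule
      by rw [htop]; trivial)
    rintro g _ ⟨w, rfl⟩
    obtain ⟨x, hx, h, rfl⟩ := hR g
    refine Submodule.subset_span ⟨x, hx, σ h w, ?_⟩
    rw [f.isIntertwining, map_mul]
    rfl
  -- V is spanned by the R-translates of the image of W. On these A is a translate of ψ, which
  -- commutes with H.
  have hAH : ∀ h v, A (ρ (φ h) v) = ρ (φ h) (A v) := by
    intro h v
    induction hspan v using Submodule.span_induction with
    | mem v hv =>
      obtain ⟨x, hx, w, rfl⟩ := hv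
      have e1 : ∀ u, ρ (φ h) (ρ x u) = ρ x (ρ (φ h) u) := fun u => by
        rw [← Module.End.mul_apply, ← Module.End.mul_apply, ← map_mul, ← map_mul, hcomm x hx]
      have e2 : ∀ u, ρ (φ h) (f u) = f (σ h u) := fun u => (f.isIntertwining _ _ h u).symm
      have e3 : ∀ u, A (ρ x u) = ρ x (A u) := fun u => hcommA r x hx u
      rw [e1, e2, e3, e3, hAf, hAf, e1, e2, ψ.isIntertwining]
    | zero => simp
    | add a b _ _ ha hb => simp only [map_add, ha, hb]
    | smul c a _ ha => simp only [map_smul, ha]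
  let Ψ : IntertwiningMap ρ ρ := LinearMap.intertwiningMap_of_isIntertwiningMap _ _ A (by
    intro g v
    obtain ⟨x, hx, h, rfl⟩ := hR g
    rw [map_mul, Module.End.mul_apply, Module.End.mul_apply]
    exact (hcommA r x hx _).trans (congrArg _ (hAH h v)))
  obtain ⟨c, hc⟩ := exists_eq_smul_of_finrank_eq_one h1 Ψ
  refine ⟨c, IntertwiningMap.ext (LinearMap.ext fun w => injective_of_ne_zero hσ f hf ?_)⟩
  exact (map_smul f.toLinearMap c w).trans ((hc (f w)).symm.trans (hAf w))

/-- The number of irreducible representations of `G = Q K`, `K` normal, which contain a given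
representation of `K` and map onto a given representation of `Q`. -/
theorem card_le_finrank_mul_finrank {Q U : Type*} [Group Q] [AddCommGroup U] [Module F U]
    [FiniteDimensional F U] (s : Q →* G) (hG : ∀ g, ∃ q h, g = s q * φ h)
    {ι : Type*} [Fintype ι] {V : ι → Type*}
    [∀ i, AddCommGroup (V i)] [∀ i, Module F (V i)]
    (ρ : ∀ i, Representation F G (V i)) (hρ : ∀ i, (ρ i).IsIrreducible)
    (hne : ∀ i j, i ≠ j → IsEmpty (Equiv (ρ i) (ρ j)))
    (f : ∀ i, IntertwiningMap σ ((ρ i).comp φ)) (hf : ∀ i, f i ≠ 0)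
    (τ : Representation F Q U)
    (p : ∀ i, IntertwiningMap ((ρ i).comp s) τ) (hp : ∀ i, p i ≠ 0) :
    Fintype.card ι ≤ Module.finrank F W * Module.finrank F U := by
  classical
  let b : ι → W →ₗ[F] U := fun i => (p i).toLinearMap ∘ₗ (f i).toLinearMap
  have hlin : LinearIndependent F b := by
    rw [Fintype.linearIndependent_iff]
    intro c hc
    by_contra! hex
    obtain ⟨i₀, hi₀⟩ := hex
    -- Only the support of a putative relation is kept, so that w ↦ (c i • f i w) is nonzero in
    -- every factor and its image generates the product.
    let J := {i // c i ≠ 0}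
    let D : W →ₗ[F] ∀ i : J, V i := LinearMap.pi fun i => c i.1 • (f i.1).toLinearMap
    have htop := eq_top_of_pairwise_not_equiv (fun i : J => ρ i.1) (fun i => hρ i.1)
      (fun i j hij => hne i.1 j.1 fun h => hij (Subtype.ext h))
      (orbitSpan _ (LinearMap.range D)) (fun i => by
        obtain ⟨w, hw⟩ := exists_apply_ne_zero (hf i.1)
        exact ⟨D w, mem_orbitSpan_of_mem _ ⟨w, rfl⟩, smul_ne_zero i.2 hw⟩)
    let P : (∀ i : J, V i) →ₗ[F] U := LinearMap.lsum F (fun i : J => V i) F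
      (fun i => (p i.1).toLinearMap)
    have hP : ∀ x, P x = ∑ i : J, p i.1 (x i) := fun x => by
      simp [P, LinearMap.lsum_apply, LinearMap.sum_apply]
    have hPD : ∀ w, ∑ i : J, c i.1 • p i.1 (f i.1 w) = 0 := by
      intro w
      have h2 := congr($hc w)
      simp only [LinearMap.sum_apply, LinearMap.smul_apply, LinearMap.comp_apply, b,
        LinearMap.zero_apply] at h2
      refine Eq.trans ((Finset.sum_subtype (Finset.univ.filter fun i => c i ≠ 0) (by simp)
        (fun i => c i • p i (f i w))).symm.trans (Finset.sum_filter_of_ne ?_)) h2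
      intro i _ h h0
      exact h (by rw [h0, zero_smul])
    -- Since every g is s q * φ h, with h moving W inside itself and q passing through the maps p i,
    -- the relation propagates from the image of D to the subspace it generates.
    have hker : ∀ x, P x = 0 := by
      intro x
      refine orbitSpan_le (p := LinearMap.ker P) _ ?_ (show x ∈ (orbitSpan
        (piRep fun i : J => ρ i.1) (LinearMap.range D)).toSubmodule by rw [htop]; trivial)
      rintro g _ ⟨w, rfl⟩
      obtain ⟨q, h, rfl⟩ := hG g
      rw [LinearMap.mem_ker, hP]
      have : ∀ i : J, p i.1 (piRep (fun i : J => ρ i.1) (s q * φ h) (D w) i) =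
          τ q (c i.1 • p i.1 (f i.1 (σ h w))) := by
        intro i
        rw [piRep_apply, map_mul, Module.End.mul_apply, (f i.1).isIntertwining]
        have e1 := (p i.1).isIntertwining _ _ q (ρ i.1 (φ h) (D w i))
        refine e1.trans (congrArg _ ?_)
        change (p i.1).toLinearMap (ρ i.1 (φ h) (c i.1 • f i.1 w)) = _
        rw [map_smul, map_smul]
        rfl
      rw [Finset.sum_congr rfl fun i _ => this i, ← map_sum, hPD, map_zero]
    obtain ⟨v, hv⟩ := exists_apply_ne_zero (hp i₀)
    apply hv
    rw [← hker (Pi.single (⟨i₀, hi₀⟩ : J) v), hP, Finset.sum_eq_single ⟨i₀, hi₀⟩]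
    · simp
    · intro j _ hj
      rw [Pi.single_eq_of_ne hj]
      exact map_zero (p j.1).toLinearMap
    · simp
  have := hlin.fintype_card_le_finrank
  rwa [Module.finrank_linearMap] at this

end Compare

/-! ### Coinduction from a subgroup of finite index -/

section Coinduced

variable {G F W : Type*} [Group G] [Field F] [AddCommGroup W] [Module F W]

/-- The action of `G` on functions on `G` by right translation. -/
def rightTranslation (G F W : Type*) [Group G] [Field F] [AddCommGroup W] [Module F W] :
    Representation F G (G → W) where
  toFun g := LinearMap.funLeft F W (· * g)
  map_one' := by ext; simp [LinearMap.funLeft]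
  map_mul' g h := by ext; simp [LinearMap.funLeft, mul_assoc]

lemma rightTranslation_apply (g x : G) (f : G → W) :
    rightTranslation G F W g f x = f (x * g) := rfl

open Classical in
/-- The function on `G` supported on the subgroup `H` which is given by the orbit map there. -/
def extendByZero {H : Subgroup G} (σ : Representation F H W) : W →ₗ[F] (G → W) where
  toFun w x := if hx : x ∈ H then σ ⟨x, hx⟩ w else 0
  map_add' v w := by
    ext x
    by_cases hx : x ∈ H <;> simp [hx]
  map_smul' c w := by
    ext x
    by_cases hx : x ∈ H <;> simp [hx]

lemma extendByZero_mul_left {H : Subgroup G} (σ : Representation F H W) (w : W) (h : H) (x : G) :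
    extendByZero σ w (h * x) = σ h (extendByZero σ w x) := by
  by_cases hx : x ∈ H
  · have h1 : (h : G) * x ∈ H := H.mul_mem h.2 hx
    simp only [extendByZero, LinearMap.coe_mk, AddHom.coe_mk, dif_pos hx, dif_pos h1]
    rw [← Module.End.mul_apply, ← map_mul]
    rfl
  · have h1 : (h : G) * x ∉ H := fun h' => hx ((H.mul_mem_cancel_left h.2).1 h')
    simp [extendByZero, hx, h1]

lemma extendByZero_mul_right {H : Subgroup G} (σ : Representation F H W) (w : W) (h : H) (x : G) :
    extendByZero σ w (x * h) = extendByZero σ (σ h w) x := by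
  by_cases hx : x ∈ H
  · have h1 : x * h ∈ H := H.mul_mem hx h.2
    simp only [extendByZero, LinearMap.coe_mk, AddHom.coe_mk, dif_pos hx, dif_pos h1]
    rw [← Module.End.mul_apply, ← map_mul]
    rfl
  · have h1 : x * h ∉ H := fun h' => hx ((H.mul_mem_cancel_right h.2).1 h')
    simp [extendByZero, hx, h1]

/-- Every irreducible representation of a subgroup of finite index is a quotient of the
restriction of an irreducible representation of the group. -/
theorem exists_irreducible_restrict_quotient [FiniteDimensional F W] {H : Subgroup G}
    (R : Finset G) (hR : ∀ g, ∃ r ∈ R, ∃ h, g = r * H.subtype h)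
    {σ : Representation F H W} (hσ : σ.IsIrreducible) :
    ∃ (n : ℕ) (ρ : Representation F G (Fin n → F))
      (p : IntertwiningMap (ρ.comp H.subtype) σ), ρ.IsIrreducible ∧ p ≠ 0 ∧
      n ≤ R.card * Module.finrank F W ∧
      ∀ k : G, (∀ g, ∃ h : H, g * k * g⁻¹ = h ∧ σ h = 1) → ρ k = 1 := by
  have := nontrivial_of_isIrreducible hσ
  let D := LinearMap.range (extendByZero σ)
  let X := orbitSpan (rightTranslation G F W) D
  obtain ⟨hfin, hrank⟩ := finrank_orbitSpan_le (rightTranslation G F W) H.subtype R hR D (by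
    rintro h _ ⟨w, rfl⟩
    exact ⟨σ h w, by ext x; rw [rightTranslation_apply, H.subtype_apply, extendByZero_mul_right]⟩)
  have hnt : Nontrivial X.toSubmodule := by
    obtain ⟨w, hw⟩ := exists_ne (0 : W)
    refine ⟨⟨⟨extendByZero σ w, mem_orbitSpan_of_mem _ ⟨w, rfl⟩⟩, 0, fun h => hw ?_⟩⟩
    have := congrFun (congrArg Subtype.val h) 1
    simpa [extendByZero, H.one_mem, show (⟨1, H.one_mem⟩ : H) = 1 from rfl] using this
  obtain ⟨n, ρ, f, hρ, hf⟩ := exists_irreducible_sub X.toRepresentation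
  have hfG : ∀ g v x, (f (ρ g v) : G → W) x = (f v : G → W) (x * g) := fun g v x => by
    rw [f.isIntertwining]; rfl
  -- The generated space lies in the coinduced module of left H-equivariant functions, so evaluation
  -- at 1 is an H-map to W.
  have hequiv : ∀ v (h : H) x, (f v : G → W) (h * x) = σ h ((f v : G → W) x) := by
    intro v h x
    let p : Submodule F (G → W) := LinearMap.ker
      ((LinearMap.proj (R := F) (φ := fun _ : G => W) ((h : G) * x)) -
        (σ h) ∘ₗ (LinearMap.proj (R := F) (φ := fun _ : G => W) x))
    have : (f v : G → W) ∈ p := by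
      refine orbitSpan_le _ ?_ (f v).2
      rintro g _ ⟨w, rfl⟩
      simp only [p, LinearMap.mem_ker, LinearMap.sub_apply, LinearMap.comp_apply,
        LinearMap.proj_apply, rightTranslation_apply]
      rw [mul_assoc, extendByZero_mul_left, sub_self]
    simpa [p, sub_eq_zero] using this
  let q : IntertwiningMap (ρ.comp H.subtype) σ :=
    LinearMap.intertwiningMap_of_isIntertwiningMap _ _
      ((LinearMap.proj (R := F) (φ := fun _ : G => W) 1) ∘ₗ X.toSubmodule.subtype ∘ₗ
        f.toLinearMap) (fun h v => by
      change (f (ρ h v) : G → W) 1 = σ h ((f v : G → W) 1)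
      rw [hfG, ← hequiv, one_mul, mul_one])
  refine ⟨n, ρ, q, hρ, ?_, ?_, ?_⟩
  · have := nontrivial_of_isIrreducible hρ
    obtain ⟨v, hv⟩ := exists_ne (0 : Fin n → F)
    obtain ⟨x, hx⟩ : ∃ x, (f v : G → W) x ≠ 0 := by
      by_contra! h
      exact hv (hf ((Subtype.ext (funext h)).trans (map_zero f.toLinearMap).symm))
    -- Right translation by x moves a nonzero value at x to the identity.
    refine ne_zero_of_apply_ne_zero q (w := ρ x v) ?_
    change (f (ρ x v) : G → W) 1 ≠ 0
    rwa [hfG, one_mul]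
  · calc n = Module.finrank F (Fin n → F) := by simp
      _ ≤ Module.finrank F X.toSubmodule :=
        LinearMap.finrank_le_finrank_of_injective (f := f.toLinearMap) hf
      _ ≤ R.card * Module.finrank F D := hrank
      _ ≤ R.card * Module.finrank F W := Nat.mul_le_mul_left _ (LinearMap.finrank_range_le _)
  · intro k hk
    refine LinearMap.ext fun v => hf (Subtype.ext (funext fun x => ?_))
    rw [hfG]
    let p : Submodule F (G → W) := LinearMap.ker
      ((LinearMap.proj (R := F) (φ := fun _ : G => W) (x * k)) -
        (LinearMap.proj (R := F) (φ := fun _ : G => W) x))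
    have : (f v : G → W) ∈ p := by
      refine orbitSpan_le _ ?_ (f v).2
      rintro g _ ⟨w, rfl⟩
      obtain ⟨h, hh, hσh⟩ := hk x
      simp only [p, LinearMap.mem_ker, LinearMap.sub_apply,
        LinearMap.proj_apply, rightTranslation_apply]
      rw [show x * k * g = h * (x * g) by rw [← hh]; group, extendByZero_mul_left, hσh]
      simp
    simpa [p, sub_eq_zero] using this

end Coinduced

/-! ### Continuity of sub-, quotient and coinduced representations -/

section Open

variable {G H F V W : Type*} [Group G] [Group H] [Field F] [AddCommGroup V] [Module F V]
  [AddCommGroup W] [Module F W]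

lemma isOpen_ker_of_le [TopologicalSpace G] [IsTopologicalGroup G] {ρ : Representation F G V}
    {σ : Representation F G W} (h : IsOpen {g | ρ g = 1}) (hle : ∀ g, ρ g = 1 → σ g = 1) :
    IsOpen {g | σ g = 1} :=
  Subgroup.isOpen_mono (H₁ := MonoidHom.ker ρ) (H₂ := MonoidHom.ker σ) hle h

lemma isOpen_ker_of_injective [TopologicalSpace G] [IsTopologicalGroup G]
    {ρ : Representation F G V} {σ : Representation F G W} (h : IsOpen {g | ρ g = 1})
    (f : IntertwiningMap σ ρ) (hf : Function.Injective f) : IsOpen {g | σ g = 1} :=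
  isOpen_ker_of_le h fun g hg => LinearMap.ext fun w => hf (by
    rw [f.isIntertwining, hg]; rfl)

lemma isOpen_ker_of_surjective [TopologicalSpace G] [IsTopologicalGroup G]
    {ρ : Representation F G V} {σ : Representation F G W} (h : IsOpen {g | ρ g = 1})
    (f : IntertwiningMap ρ σ) (hf : Function.Surjective f) : IsOpen {g | σ g = 1} :=
  isOpen_ker_of_le h fun g hg => LinearMap.ext fun w => by
    obtain ⟨v, rfl⟩ := hf w
    rw [← f.isIntertwining, hg]; rfl

lemma isOpen_ker_comp [TopologicalSpace G] [TopologicalSpace H] {ρ : Representation F G V}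
    (h : IsOpen {g | ρ g = 1}) {φ : H →* G} (hφ : Continuous φ) :
    IsOpen {g | (ρ.comp φ : Representation F H V) g = 1} :=
  h.preimage hφ

/-- In a profinite group, the condition on the kernel in
`exists_irreducible_restrict_quotient` forces the kernel to be open. -/
lemma isOpen_ker_of_conj [TopologicalSpace G] [IsTopologicalGroup G] [CompactSpace G]
    [TotallyDisconnectedSpace G] {H : Subgroup G} (hH : IsOpen (H : Set G))
    {σ : Representation F H W} (hσ : IsOpen {h | σ h = 1}) {ρ : Representation F G V}
    (h : ∀ k : G, (∀ g, ∃ h : H, g * k * g⁻¹ = h ∧ σ h = 1) → ρ k = 1) :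
    IsOpen {g | ρ g = 1} := by
  have hU : IsOpen ((↑) '' {h : H | σ h = 1} : Set G) := hH.isOpenMap_subtype_val _ hσ
  -- An open normal subgroup inside ker σ has all its conjugates in ker σ, so it acts trivially
  -- through ρ.
  obtain ⟨N, hN⟩ := ProfiniteGrp.exist_openNormalSubgroup_sub_open_nhds_of_one hU
    ⟨1, by simp, rfl⟩
  refine Subgroup.isOpen_mono (H₁ := N.toSubgroup) (H₂ := MonoidHom.ker ρ) ?_ N.isOpen
  intro k hk
  refine h k fun g => ?_
  obtain ⟨x, hx, hx'⟩ := hN (N.isNormal'.conj_mem k hk g)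
  exact ⟨x, hx'.symm, hx⟩

end Open

end Representation

/-! ### Weighted sums over irreducible representations of one field -/

namespace WeilZeta
open Representation
universe u v

/-- Comparison of two series of nonnegative terms along a map with finite fibers. -/
theorem tsum_le_tsum_mul_of_fiber {α β : Type*} (r : α → β) (w : α → ℝ≥0∞) (w' : β → ℝ≥0∞)
    (M : β → ℕ) (hM : ∀ b, ∀ s : Finset α, (∀ a ∈ s, r a = b) → s.card ≤ M b)
    (hw : ∀ a, w a ≤ w' (r a)) : ∑' a, w a ≤ ∑' b, (M b : ℝ≥0∞) * w' b := by
  classical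
  calc ∑' a, w a ≤ ∑' a, w' (r a) := ENNReal.tsum_le_tsum hw
    _ = ∑' (x : Σ b, {a // r a = b}), w' (r x.2) :=
      ((Equiv.sigmaFiberEquiv r).tsum_eq fun a => w' (r a)).symm
    _ = ∑' b, ∑' (a : {a // r a = b}), w' b := by
      rw [ENNReal.tsum_sigma']
      exact tsum_congr fun b => tsum_congr fun a => by rw [a.2]
    _ ≤ ∑' b, (M b : ℝ≥0∞) * w' b := by
      refine ENNReal.tsum_le_tsum fun b => ?_
      rw [ENNReal.tsum_eq_iSup_sum]
      refine iSup_le fun s => ?_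
      rw [Finset.sum_const, nsmul_eq_mul]
      refine mul_le_mul_left ?_ _
      have := hM b (s.map (Function.Embedding.subtype _)) (by simp +contextual)
      rw [Finset.card_map] at this
      exact_mod_cast this

/-- The irreducible continuous representations of `G` over `F` on the spaces `F ^ n`. -/
def IrrRep (G : Type u) [Group G] [TopologicalSpace G] (F : Type v) [Field F] : Type (max u v) :=
  {x : Σ n : ℕ, Representation F G (Fin n → F) //
    IsOpen {g : G | x.2 g = 1} ∧ x.2.IsIrreducible}

instance IrrRep.setoid (G : Type u) [Group G] [TopologicalSpace G] (F : Type v) [Field F] :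
    Setoid (IrrRep G F) where
  r x y := Nonempty (Representation.Equiv x.1.2 y.1.2)
  iseqv :=
    { refl := fun x => ⟨Representation.Equiv.refl x.1.2⟩
      symm := fun ⟨e⟩ => ⟨e.symm⟩
      trans := fun ⟨e⟩ ⟨f⟩ => ⟨e.trans f⟩ }

/-- The isomorphism classes of finite-dimensional irreducible continuous representations. -/
def IrrClass (G : Type u) [Group G] [TopologicalSpace G] (F : Type v) [Field F] :
    Type (max u v) :=
  Quotient (IrrRep.setoid G F)

namespace IrrClass

variable {G : Type u} [Group G] [TopologicalSpace G] {F : Type v} [Field F]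

/-- The dimension. -/
def dim (c : IrrClass G F) : ℕ := (Quotient.out c).1.1

/-- A representative. -/
def rep (c : IrrClass G F) : Representation F G (Fin c.dim → F) := (Quotient.out c).1.2

/-- The dimension of the endomorphism algebra. -/
def deg (c : IrrClass G F) : ℕ := Module.finrank F (IntertwiningMap c.rep c.rep)

lemma isOpen_ker (c : IrrClass G F) : IsOpen {g : G | c.rep g = 1} := (Quotient.out c).2.1

lemma isIrreducible (c : IrrClass G F) : c.rep.IsIrreducible := (Quotient.out c).2.2

lemma eq_of_equiv {c d : IrrClass G F} (e : Equiv c.rep d.rep) : c = d := by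
  rw [← Quotient.out_eq c, ← Quotient.out_eq d]
  exact Quotient.sound ⟨e⟩

lemma isEmpty_equiv {c d : IrrClass G F} (h : c ≠ d) : IsEmpty (Equiv c.rep d.rep) :=
  ⟨fun e => h (eq_of_equiv e)⟩

lemma exists_equiv {n : ℕ} (ρ : Representation F G (Fin n → F)) (ho : IsOpen {g : G | ρ g = 1})
    (hρ : ρ.IsIrreducible) : ∃ c : IrrClass G F, c.dim = n ∧ Nonempty (Equiv ρ c.rep) := by
  let x : IrrRep G F := ⟨⟨n, ρ⟩, ho, hρ⟩
  have e : Nonempty (Equiv ρ (rep (Quotient.mk _ x))) :=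
    (Quotient.mk_out (s := IrrRep.setoid G F) x).elim fun e => ⟨e.symm⟩
  refine ⟨Quotient.mk _ x, ?_, e⟩
  obtain ⟨e⟩ := e
  simpa using e.toLinearEquiv.finrank_eq.symm

lemma nontrivial (c : IrrClass G F) : Nontrivial (Fin c.dim → F) :=
  nontrivial_of_isIrreducible c.isIrreducible

lemma dim_pos (c : IrrClass G F) : 0 < c.dim := by
  have := c.nontrivial
  simpa using Module.finrank_pos (R := F) (M := Fin c.dim → F)

lemma deg_pos (c : IrrClass G F) : 0 < c.deg := by
  obtain ⟨v, hv⟩ := @exists_ne _ c.nontrivial (0 : Fin c.dim → F)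
  have : Nontrivial (IntertwiningMap c.rep c.rep) := ⟨⟨1, 0, ne_zero_of_apply_ne_zero 1 hv⟩⟩
  exact Module.finrank_pos

/-- Evaluation at a nonzero vector is injective on endomorphisms, as the nonzero ones are injective.
-/
lemma deg_le_dim (c : IrrClass G F) : c.deg ≤ c.dim := by
  obtain ⟨v, hv⟩ := @exists_ne _ c.nontrivial (0 : Fin c.dim → F)
  let ev : IntertwiningMap c.rep c.rep →ₗ[F] (Fin c.dim → F) :=
    (LinearMap.applyₗ v) ∘ₗ IntertwiningMap.toLinearMapl _ _
  have hinj : Function.Injective ev := by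
    rw [injective_iff_map_eq_zero]
    intro ψ hψ
    by_contra h
    exact hv (injective_of_ne_zero c.isIrreducible ψ h
      (show ψ v = ψ 0 from hψ.trans (map_zero ψ.toLinearMap).symm))
  simpa [deg] using LinearMap.finrank_le_finrank_of_injective hinj

/-- The contribution of an irreducible representation to the zeta function. -/
def weight (t : ℝ) (c : IrrClass G F) : ℝ≥0∞ :=
  -- With Q = |F|^deg and d = dim / deg this is Q^(-td + d - 1), the weight of the corresponding
  -- absolutely irreducible representation over the field of order Q.
  (Nat.card F : ℝ≥0∞) ^ (-(t * c.dim) + c.dim - c.deg)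

end IrrClass

/-- The contribution of the irreducible representations over `F`. -/
def irrSum (G : Type u) [Group G] [TopologicalSpace G] (F : Type v) [Field F] (t : ℝ) : ℝ≥0∞ :=
  ∑' c : IrrClass G F, c.weight t

/-- The contribution of the irreducible representations over `F` with only scalar
endomorphisms. -/
def absSum (G : Type u) [Group G] [TopologicalSpace G] (F : Type v) [Field F] (t : ℝ) : ℝ≥0∞ :=
  ∑' c : {c : IrrClass G F // c.deg = 1}, c.1.weight t

lemma one_le_card (F : Type v) [Field F] [Finite F] : (1 : ℝ≥0∞) ≤ Nat.card F := by
  exact_mod_cast Nat.card_pos (α := F)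

/-! ### Inequalities between the sums of two groups over one finite field -/

section Compare

variable {G : Type*} [Group G] [TopologicalSpace G] {H : Type*} [Group H] [TopologicalSpace H]
  {F : Type} [Field F]

lemma exists_sub [IsTopologicalGroup H] {φ : H →* G} (hφ : Continuous φ) (c : IrrClass G F) :
    ∃ (d : IrrClass H F) (f : IntertwiningMap d.rep (c.rep.comp φ)), f ≠ 0 := by
  have := c.nontrivial
  obtain ⟨n, τ, f, hτ, hf⟩ := exists_irreducible_sub (c.rep.comp φ : Representation F H _)
  obtain ⟨d, -, ⟨e⟩⟩ := IrrClass.exists_equiv τ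
    (isOpen_ker_of_injective (isOpen_ker_comp c.isOpen_ker hφ) f hf) hτ
  refine ⟨d, f.comp e.symm.toIntertwiningMap, ?_⟩
  obtain ⟨v, hv⟩ := @exists_ne _ d.nontrivial (0 : Fin d.dim → F)
  refine ne_zero_of_apply_ne_zero _ (w := v) fun h => hv ?_
  exact (hf.comp e.toLinearEquiv.symm.injective)
    (h.trans (map_zero (f.comp e.symm.toIntertwiningMap).toLinearMap).symm)

lemma exists_quotient [IsTopologicalGroup H] {φ : H →* G} (hφ : Continuous φ) (c : IrrClass G F) :
    ∃ (d : IrrClass H F) (p : IntertwiningMap (c.rep.comp φ) d.rep), p ≠ 0 := by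
  have := c.nontrivial
  obtain ⟨n, τ, p, hτ, hp⟩ := exists_irreducible_quotient (c.rep.comp φ : Representation F H _)
  obtain ⟨d, -, ⟨e⟩⟩ := IrrClass.exists_equiv τ
    (isOpen_ker_of_surjective (isOpen_ker_comp c.isOpen_ker hφ) p hp) hτ
  refine ⟨d, e.toIntertwiningMap.comp p, ?_⟩
  obtain ⟨v, hv⟩ := @exists_ne _ d.nontrivial (0 : Fin d.dim → F)
  obtain ⟨w, rfl⟩ := (e.toLinearEquiv.surjective.comp hp) v
  exact ne_zero_of_apply_ne_zero _ (w := w) hv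

/-- The dimensions in the fiber add up to at most |R| · dim d, while each is at least dim d. -/
lemma card_fiber_sub {φ : H →* G} (R : Finset G) (hR : ∀ g, ∃ r ∈ R, ∃ h, g = r * φ h)
    (d : IrrClass H F) (s : Finset (IrrClass G F))
    (hs : ∀ c ∈ s, ∃ f : IntertwiningMap d.rep (c.rep.comp φ), f ≠ 0) : s.card ≤ R.card := by
  choose f hf using hs
  have h1 := sum_finrank_le_of_sub (φ := φ) (σ := d.rep) (ι := s) (fun c => c.1.rep)
    (fun c => c.1.isIrreducible) (fun c c' h => IrrClass.isEmpty_equiv fun h' => h (Subtype.ext h'))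
    (fun c => f c.1 c.2) (fun c => hf c.1 c.2) R hR
  have h2 : ∀ c : s, d.dim ≤ c.1.dim := fun c => by
    simpa using finrank_le_of_intertwiningMap d.isIrreducible (f c.1 c.2) (hf c.1 c.2)
  have h3 : s.card * d.dim ≤ R.card * d.dim := by
    calc s.card * d.dim = ∑ _c : s, d.dim := by simp
      _ ≤ ∑ c : s, c.1.dim := Finset.sum_le_sum fun c _ => h2 c
      _ ≤ R.card * d.dim := by simpa using h1
  exact Nat.le_of_mul_le_mul_right h3 d.dim_pos

lemma dim_le_of_sub {φ : H →* G} (R : Finset G) (hR : ∀ g, ∃ r ∈ R, ∃ h, g = r * φ h)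
    {c : IrrClass G F} (hc : c.deg = 1) {d : IrrClass H F}
    {f : IntertwiningMap d.rep (c.rep.comp φ)} (hf : f ≠ 0) :
    d.dim ≤ c.dim ∧ d.deg * c.dim ≤ R.card * d.dim := by
  refine ⟨by simpa using finrank_le_of_intertwiningMap d.isIrreducible f hf, ?_⟩
  simpa [IrrClass.deg] using finrank_end_mul_le_of_sub c.isIrreducible hc d.isIrreducible f hf R hR

variable [IsTopologicalGroup H] [Finite F]

/-- A group with an open subgroup: bound of the series of the group. -/
theorem absSum_le_irrSum {φ : H →* G} (hφ : Continuous φ) (R : Finset G)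
    (hR : ∀ g, ∃ r ∈ R, ∃ h, g = r * φ h) {s : ℝ} (hs : 1 ≤ s) :
    absSum G F (s + 1 - 1 / R.card) ≤ R.card * irrSum H F s := by
  choose r f hf using fun c : IrrClass G F => exists_sub hφ c
  rw [irrSum, ← ENNReal.tsum_mul_left]
  refine tsum_le_tsum_mul_of_fiber (fun c : {c : IrrClass G F // c.deg = 1} => r c.1) _
    (fun d => d.weight s) (fun _ => R.card) ?_ ?_
  · intro d S hS
    rw [← Finset.card_map (Function.Embedding.subtype _)]
    refine card_fiber_sub (φ := φ) R hR d _ fun c hc => ?_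
    obtain ⟨c, hcS, rfl⟩ := Finset.mem_map.1 hc
    obtain rfl := hS c hcS
    exact ⟨f c.1, hf c.1⟩
  · rintro ⟨c, hc⟩
    obtain ⟨h1, h2⟩ := dim_le_of_sub R hR hc (hf c)
    refine ENNReal.rpow_le_rpow_of_exponent_le (one_le_card F) ?_
    simp only
    rw [hc]
    have hl := (r c).deg_pos
    have hn := (r c).deg_le_dim
    have hm : 0 < R.card := by
      obtain ⟨x, hx, -⟩ := hR 1
      exact Finset.card_pos.2 ⟨x, hx⟩
    have h1' : ((r c).dim : ℝ) ≤ c.dim := by exact_mod_cast h1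
    have h2' : ((r c).deg : ℝ) * c.dim ≤ R.card * (r c).dim := by exact_mod_cast h2
    have hl' : (1 : ℝ) ≤ (r c).deg := by exact_mod_cast hl
    have hn' : ((r c).deg : ℝ) ≤ (r c).dim := by exact_mod_cast hn
    have hm' : (0 : ℝ) < R.card := by exact_mod_cast hm
    generalize ((r c).dim : ℝ) = w at *
    generalize ((r c).deg : ℝ) = l at *
    generalize (R.card : ℝ) = m at *
    generalize (c.dim : ℝ) = N at *
    have h3 : 1 / m * N ≤ w / l := by
      rw [one_div_mul_eq_div, div_le_div_iff₀ hm' (by linarith)]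
      linarith
    -- Equivalent to (l - 1)(w - l) ≥ 0. With N/m ≤ w/l it gives N/m - 1 ≤ w - l, which is exactly
    -- what the shift 1 - 1/m requires.
    have h4 : w / l + l ≤ w + 1 := by
      have hl0 : 0 < l := by linarith
      rw [div_add' _ _ _ hl0.ne', div_le_iff₀ hl0]
      nlinarith
    push_cast
    nlinarith [mul_le_mul_of_nonneg_left h1' (by linarith : (0 : ℝ) ≤ s)]

/-- A group generated by a subgroup and finitely many elements commuting with it. -/
theorem absSum_le_irrSum_of_commute {φ : H →* G} (hφ : Continuous φ) (R : Finset G)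
    (hR : ∀ g, ∃ r ∈ R, ∃ h, g = r * φ h) (hcomm : ∀ r ∈ R, ∀ h, r * φ h = φ h * r)
    {s : ℝ} (hs : 1 ≤ s) :
    absSum G F s ≤ R.card * irrSum H F s := by
  choose r f hf using fun c : IrrClass G F => exists_sub hφ c
  rw [irrSum, ← ENNReal.tsum_mul_left]
  refine tsum_le_tsum_mul_of_fiber (fun c : {c : IrrClass G F // c.deg = 1} => r c.1) _
    (fun d => d.weight s) (fun _ => R.card) ?_ ?_
  · intro d S hS
    rw [← Finset.card_map (Function.Embedding.subtype _)]
    refine card_fiber_sub (φ := φ) R hR d _ fun c hc => ?_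
    obtain ⟨c, hcS, rfl⟩ := Finset.mem_map.1 hc
    obtain rfl := hS c hcS
    exact ⟨f c.1, hf c.1⟩
  · rintro ⟨c, hc⟩
    obtain ⟨h1, -⟩ := dim_le_of_sub R hR hc (hf c)
    -- With both degrees 1 and s ≥ 1, the weight decreases with the dimension, so no shift of s is
    -- needed.
    have h2 : (r c).deg = 1 := finrank_end_eq_one_of_commute c.isIrreducible hc
      (r c).isIrreducible (f c) (hf c) (R : Set G) hR hcomm
    refine ENNReal.rpow_le_rpow_of_exponent_le (one_le_card F) ?_
    simp only
    rw [hc, h2]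
    have h1' : ((r c).dim : ℝ) ≤ c.dim := by exact_mod_cast h1
    nlinarith

/-- An open subgroup of a profinite group: bound of the series of the subgroup. -/
theorem absSum_subgroup_le_irrSum [IsTopologicalGroup G] [CompactSpace G]
    [TotallyDisconnectedSpace G] (H : Subgroup G) (hH : IsOpen (H : Set G)) (R : Finset G)
    (hR : ∀ g, ∃ r ∈ R, ∃ h, g = r * H.subtype h) {t : ℝ} (ht : 1 ≤ t) :
    absSum H F (R.card * t) ≤ R.card * irrSum G F t := by
  have hex : ∀ d : IrrClass H F, ∃ (c : IrrClass G F)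
      (p : IntertwiningMap (c.rep.comp H.subtype) d.rep), p ≠ 0 ∧ c.dim ≤ R.card * d.dim := by
    intro d
    obtain ⟨n, ρ, p, hρ, hp, hn, hk⟩ := exists_irreducible_restrict_quotient R hR d.isIrreducible
    obtain ⟨c, hc, ⟨e⟩⟩ := IrrClass.exists_equiv ρ (isOpen_ker_of_conj hH d.isOpen_ker hk) hρ
    let e' : IntertwiningMap (c.rep.comp H.subtype) (ρ.comp H.subtype) :=
      LinearMap.intertwiningMap_of_isIntertwiningMap _ _ e.symm.toLinearMap
        (fun h v => e.symm.toIntertwiningMap.isIntertwining _ _ (h : G) v)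
    refine ⟨c, p.comp e', ?_, by simpa [hc] using hn⟩
    obtain ⟨v, hv⟩ := exists_apply_ne_zero hp
    refine ne_zero_of_apply_ne_zero _ (w := e v) ?_
    change p (e.symm (e v)) ≠ 0
    rwa [e.symm_apply_apply]
  choose r p hp hr using hex
  rw [irrSum, ← ENNReal.tsum_mul_left]
  have hdim : ∀ d : IrrClass H F, d.deg = 1 → (r d).deg * d.dim ≤ (r d).dim := fun d hd => by
    simpa [IrrClass.deg] using
      finrank_end_mul_le_of_quotient (r d).isIrreducible d.isIrreducible hd (p d) (hp d)
  refine tsum_le_tsum_mul_of_fiber (fun d : {d : IrrClass H F // d.deg = 1} => r d.1) _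
    (fun c => c.weight t) (fun _ => R.card) ?_ ?_
  · intro c S hS
    have hp' : ∀ d : S, ∃ q : IntertwiningMap (c.rep.comp H.subtype) d.1.1.rep, q ≠ 0 := by
      intro d
      have := hS d.1 d.2
      subst this
      exact ⟨_, hp d.1.1⟩
    choose q hq using hp'
    have h1 := sum_finrank_le_of_quotient (φ := H.subtype) (ρ := c.rep) (ι := S)
      (fun d => d.1.1.rep) (fun d => d.1.1.isIrreducible)
      (fun d d' h => IrrClass.isEmpty_equiv fun h' => h (Subtype.ext (Subtype.ext h'))) q hq
    -- The dimensions of the d in the fiber sum to at most dim c, and each is at least dim c / |R|.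
    have h2 : ∀ d : S, c.dim ≤ R.card * d.1.1.dim := fun d => by
      rw [← hS d.1 d.2]
      exact hr d.1.1
    have h3 : S.card * c.dim ≤ R.card * c.dim := by
      calc S.card * c.dim = ∑ _d : S, c.dim := by simp
        _ ≤ ∑ d : S, R.card * d.1.1.dim := Finset.sum_le_sum fun d _ => h2 d
        _ = R.card * ∑ d : S, d.1.1.dim := by rw [Finset.mul_sum]
        _ ≤ R.card * c.dim := Nat.mul_le_mul_left _ (by simpa using h1)
    exact Nat.le_of_mul_le_mul_right h3 c.dim_pos
  · rintro ⟨d, hd⟩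
    refine ENNReal.rpow_le_rpow_of_exponent_le (one_le_card F) ?_
    simp only
    have h1 : ((r d).deg : ℝ) * d.dim ≤ (r d).dim := by exact_mod_cast hdim d hd
    have h2 : ((r d).dim : ℝ) ≤ R.card * d.dim := by exact_mod_cast hr d
    have h3 : (1 : ℝ) ≤ (r d).deg := by exact_mod_cast (r d).deg_pos
    have h4 : (1 : ℝ) ≤ d.dim := by exact_mod_cast d.dim_pos
    rw [hd]
    push_cast
    -- The product (l - 1)(w - 1) ≥ 0 yields w - 1 ≤ lw - l ≤ N - l, where N, l belong to the group
    -- and w to the subgroup; N ≤ |R| w handles the terms with t.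
    nlinarith [mul_nonneg (sub_nonneg.2 h3) (sub_nonneg.2 h4)]

/-- A split extension: bound of the series of the group. -/
theorem absSum_le_of_split {Q : Type*} [Group Q] [TopologicalSpace Q] [IsTopologicalGroup Q]
    {φ : H →* G} (hφ : Continuous φ) {σ : Q →* G} (hσ : Continuous σ)
    (hG : ∀ g, ∃ q h, g = σ q * φ h) {s t ε : ℝ} (hs : 0 ≤ s) (ht : 0 ≤ t) (hε : 0 ≤ ε)
    {C : ℝ≥0∞} (hC : ∀ n : ℕ, (n : ℝ≥0∞) * (Nat.card F : ℝ≥0∞) ^ (-(ε * n)) ≤ C) :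
    absSum G F (s + t + 1 + 2 * ε) ≤ C ^ 2 * (irrSum H F s * irrSum Q F t) := by
  choose r f hf using fun c : IrrClass G F => exists_sub hφ c
  choose r' p hp using fun c : IrrClass G F => exists_quotient hσ c
  have hq0 : (Nat.card F : ℝ≥0∞) ≠ 0 := by exact_mod_cast (Nat.card_pos (α := F)).ne'
  have hqt : (Nat.card F : ℝ≥0∞) ≠ ⊤ := ENNReal.natCast_ne_top _
  -- The two factors with ε compensate the fiber size, the product of the two dimensions; they are
  -- paid for by 2ε on the left.
  let w : IrrClass H F × IrrClass Q F → ℝ≥0∞ := fun x =>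
    (Nat.card F : ℝ≥0∞) ^ (-(ε * x.1.dim)) * (Nat.card F : ℝ≥0∞) ^ (-(ε * x.2.dim)) *
      (x.1.weight s * x.2.weight t)
  calc absSum G F (s + t + 1 + 2 * ε)
      ≤ ∑' x : IrrClass H F × IrrClass Q F, ((x.1.dim * x.2.dim : ℕ) : ℝ≥0∞) * w x := by
        refine tsum_le_tsum_mul_of_fiber
          (fun c : {c : IrrClass G F // c.deg = 1} => (r c.1, r' c.1)) _ w _ ?_ ?_
        · rintro ⟨d, d'⟩ S hS
          have hf' : ∀ c : S, ∃ g : IntertwiningMap d.rep (c.1.1.rep.comp φ), g ≠ 0 := by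
            intro c
            obtain rfl : r c.1.1 = d := congrArg Prod.fst (hS c.1 c.2)
            exact ⟨_, hf c.1.1⟩
          have hp' : ∀ c : S, ∃ g : IntertwiningMap (c.1.1.rep.comp σ) d'.rep, g ≠ 0 := by
            intro c
            obtain rfl : r' c.1.1 = d' := congrArg Prod.snd (hS c.1 c.2)
            exact ⟨_, hp c.1.1⟩
          choose f' hf' using hf'
          choose p' hp' using hp'
          have := card_le_finrank_mul_finrank (φ := φ) (σ := d.rep) σ hG (ι := S)
            (fun c => c.1.1.rep) (fun c => c.1.1.isIrreducible)
            (fun c c' h => IrrClass.isEmpty_equiv fun h' => h (Subtype.ext (Subtype.ext h')))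
            f' hf' d'.rep p' hp'
          simpa using this
        · rintro ⟨c, hc⟩
          simp only [w, IrrClass.weight]
          rw [← ENNReal.rpow_add _ _ hq0 hqt, ← ENNReal.rpow_add _ _ hq0 hqt,
            ← ENNReal.rpow_add _ _ hq0 hqt]
          refine ENNReal.rpow_le_rpow_of_exponent_le (one_le_card F) ?_
          have h1 : ((r c).dim : ℝ) ≤ c.dim := by
            exact_mod_cast (show (r c).dim ≤ c.dim by
              simpa using finrank_le_of_intertwiningMap (r c).isIrreducible (f c) (hf c))
          have h2 : ((r' c).dim : ℝ) ≤ c.dim := by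
            have := LinearMap.finrank_le_finrank_of_surjective (f := (p c).toLinearMap)
              (surjective_of_ne_zero (r' c).isIrreducible (p c) (hp c))
            exact_mod_cast (show (r' c).dim ≤ c.dim by simpa using this)
          have h3 : ((r c).deg : ℝ) ≤ (r c).dim := by exact_mod_cast (r c).deg_le_dim
          have h4 : ((r' c).deg : ℝ) ≤ (r' c).dim := by exact_mod_cast (r' c).deg_le_dim
          rw [hc]
          push_cast
          nlinarith [mul_le_mul_of_nonneg_left h1 hs, mul_le_mul_of_nonneg_left h2 ht,
            mul_le_mul_of_nonneg_left h1 hε, mul_le_mul_of_nonneg_left h2 hε]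
    _ ≤ ∑' x : IrrClass H F × IrrClass Q F, C ^ 2 * (x.1.weight s * x.2.weight t) := by
        refine ENNReal.tsum_le_tsum fun x => ?_
        have := mul_le_mul' (hC x.1.dim) (hC x.2.dim)
        calc _ = ((x.1.dim : ℝ≥0∞) * (Nat.card F : ℝ≥0∞) ^ (-(ε * x.1.dim)) *
              ((x.2.dim : ℝ≥0∞) * (Nat.card F : ℝ≥0∞) ^ (-(ε * x.2.dim)))) *
              (x.1.weight s * x.2.weight t) := by
                simp only [w]; push_cast; ring
          _ ≤ _ := by
            rw [pow_two]
            exact mul_le_mul_left this _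
    _ = C ^ 2 * (irrSum H F s * irrSum Q F t) := by
        rw [ENNReal.tsum_mul_left, ENNReal.tsum_prod
          (f := fun (c : IrrClass H F) (d : IrrClass Q F) => c.weight s * d.weight t)]
        congr 1
        rw [irrSum, irrSum, ← ENNReal.tsum_mul_right]
        exact tsum_congr fun c => ENNReal.tsum_mul_left

end Compare

end WeilZeta

namespace Representation

lemma finrank_end_eq_of_equiv {G F X Y : Type*} [Group G] [Field F] [AddCommGroup X] [Module F X]
    [AddCommGroup Y] [Module F Y] {ρ : Representation F G X} {τ : Representation F G Y}
    (e : Equiv ρ τ) :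
    Module.finrank F (IntertwiningMap ρ ρ) = Module.finrank F (IntertwiningMap τ τ) :=
  LinearEquiv.finrank_eq
    { toFun := fun ψ => e.toIntertwiningMap.comp (ψ.comp e.symm.toIntertwiningMap)
      invFun := fun ψ => e.symm.toIntertwiningMap.comp (ψ.comp e.toIntertwiningMap)
      map_add' := fun _ _ =>
        IntertwiningMap.ext (LinearMap.ext fun _ => map_add e.toLinearEquiv _ _)
      map_smul' := fun _ _ => by
        rw [IntertwiningMap.smul_comp, IntertwiningMap.comp_smul]; rfl
      left_inv := fun ψ => IntertwiningMap.ext (LinearMap.ext fun v => by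
        change e.symm (e (ψ (e.symm (e v)))) = ψ v
        rw [e.symm_apply_apply, e.symm_apply_apply])
      right_inv := fun ψ => IntertwiningMap.ext (LinearMap.ext fun v => by
        change e (e.symm (ψ (e (e.symm v)))) = ψ v
        rw [e.apply_symm_apply, e.apply_symm_apply]) }

end Representation

namespace WeilZeta
open Representation
universe u v

/-! ### Estimates for series -/

section Analysis

/-- Exponential decay beats linear growth, uniformly in the base. -/
theorem exists_mul_rpow_le {ε : ℝ} (hε : 0 < ε) :
    ∃ C : ℝ≥0∞, C ≠ ⊤ ∧ ∀ q : ℕ, 2 ≤ q → ∀ n : ℕ,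
      (n : ℝ≥0∞) * (q : ℝ≥0∞) ^ (-(ε * n)) ≤ C := by
  refine ⟨ENNReal.ofReal (1 / (ε * Real.log 2)), ENNReal.ofReal_ne_top, fun q hq n => ?_⟩
  have hl : 0 < Real.log 2 := Real.log_pos one_lt_two
  have h0 : (0 : ℝ) ≤ ε * n := by positivity
  have h1 : (2 : ℝ≥0∞) ^ (ε * n) ≤ (q : ℝ≥0∞) ^ (ε * n) :=
    ENNReal.rpow_le_rpow (by exact_mod_cast hq) h0
  -- From x + 1 ≤ exp x with x = ε n log 2. Base 2 is the worst case.
  have h2 : (n : ℝ) ≤ 1 / (ε * Real.log 2) * 2 ^ (ε * n) := by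
    rw [Real.rpow_def_of_pos two_pos, one_div, ← div_eq_inv_mul, le_div_iff₀ (by positivity)]
    have := Real.add_one_le_exp (Real.log 2 * (ε * n))
    linarith
  have h3 : (n : ℝ≥0∞) ≤ ENNReal.ofReal (1 / (ε * Real.log 2)) * 2 ^ (ε * n) := by
    have := ENNReal.ofReal_le_ofReal h2
    rwa [ENNReal.ofReal_natCast, ENNReal.ofReal_mul (by positivity),
      ← ENNReal.ofReal_rpow_of_pos two_pos, ENNReal.ofReal_ofNat] at this
  rw [ENNReal.rpow_neg, ← div_eq_mul_inv]
  exact ENNReal.div_le_of_le_mul (h3.trans (mul_le_mul_right h1 _))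

/-- Prime powers with positive exponent are distinct integers, so this is a subseries of ∑ n^(-t).
-/
lemma tsum_prime_pow_ne_top {t : ℝ} (ht : 1 < t) :
    ∑' (p : Nat.Primes) (j : ℕ+), (((p : ℕ) ^ (j : ℕ) : ℕ) : ℝ≥0∞) ^ (-t) ≠ ⊤ := by
  rw [← ENNReal.tsum_prod (f := fun (p : Nat.Primes) (j : ℕ+) =>
    (((p : ℕ) ^ (j : ℕ) : ℕ) : ℝ≥0∞) ^ (-t))]
  have hs : Summable fun n : ℕ => (n : ℝ) ^ (-t) := Real.summable_nat_rpow.2 (by linarith)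
  have hinj : Function.Injective fun x : Nat.Primes × ℕ+ => (x.1 : ℕ) ^ (x.2 : ℕ) := by
    rintro ⟨p, i⟩ ⟨q, j⟩ h
    simp only at h
    have hpq : p = q := by
      have h1 : (p : ℕ) ∣ (q : ℕ) ^ (j : ℕ) := h ▸ dvd_pow_self _ i.ne_zero
      exact Subtype.ext ((Nat.prime_dvd_prime_iff_eq p.2 q.2).1 (p.2.dvd_of_dvd_pow h1))
    subst hpq
    rw [PNat.eq (Nat.pow_right_injective p.2.two_le h)]
  refine ne_top_of_le_ne_top hs.tsum_ofReal_ne_top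
    (le_trans (ENNReal.tsum_le_tsum fun x => ?_) (ENNReal.tsum_comp_le_tsum_of_injective hinj _))
  have hpos : 0 < ((x.1 : ℕ) ^ (x.2 : ℕ) : ℕ) := pow_pos x.1.2.pos _
  rw [← ENNReal.ofReal_natCast, ENNReal.ofReal_rpow_of_pos (by exact_mod_cast hpos)]

/-- A sum over all factorizations. -/
theorem tsum_mul_le (g : ℕ+ → ℝ≥0∞) :
    ∑' (j : ℕ+) (l : ℕ+), g (j * l) ≤ ∑' k : ℕ+, ((k : ℕ) : ℝ≥0∞) * g k := by
  rw [← ENNReal.tsum_prod (f := fun (j l : ℕ+) => g (j * l))]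
  refine tsum_le_tsum_mul_of_fiber (fun x : ℕ+ × ℕ+ => x.1 * x.2) _ g (fun k => (k : ℕ)) ?_
    fun _ => le_rfl
  intro k s hs
  refine (Finset.card_le_card_of_injOn (t := Finset.Icc 1 (k : ℕ)) (fun x => (x.1 : ℕ)) ?_ ?_).trans
    (by simp)
  · intro x hx
    have := hs x hx
    simp only [Finset.coe_Icc, Set.mem_Icc]
    refine ⟨x.1.pos, ?_⟩
    rw [← this, PNat.mul_coe]
    exact Nat.le_mul_of_pos_right _ x.2.pos
  · intro x hx y hy hxy
    have h1 := (hs x hx).trans (hs y hy).symm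
    have h2 : x.1 = y.1 := PNat.eq hxy
    rw [h2] at h1
    exact Prod.ext h2 (mul_left_cancel h1)

end Analysis

/-! ### From isomorphism classes to the counting function `rStar` -/

section Counting

variable {G : Type u} [Group G] [TopologicalSpace G]

lemma rStar_mul {F : Type v} [Field F] (n : ℕ) (x : ℝ≥0∞) :
    (rStar G F n : ℝ≥0∞) * x = ∑' _ : Quotient (AbsIrrep.setoid G F n), x := by
  rw [ENNReal.tsum_const]; rfl

/-- The absolutely irreducible representations are the irreducible ones with only scalar
endomorphisms. -/
theorem tsum_rStar_le_absSum {F : Type} [Field F] (t : ℝ) :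
    ∑' n : ℕ+, (rStar G F n : ℝ≥0∞) * (Nat.card F : ℝ≥0∞) ^ (-(t * (n : ℕ)) + (n : ℕ) - 1) ≤
      absSum G F t := by
  have hex : ∀ x : Σ n : ℕ+, Quotient (AbsIrrep.setoid G F n),
      ∃ c : {c : IrrClass G F // c.deg = 1}, c.1.dim = x.1 ∧
        Nonempty (Equiv (Quotient.out x.2).1 c.1.rep) := by
    intro x
    obtain ⟨c, hc, ⟨e⟩⟩ := IrrClass.exists_equiv (Quotient.out x.2).1 (Quotient.out x.2).2.1
      (Quotient.out x.2).2.2.1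
    refine ⟨⟨c, ?_⟩, hc, ⟨e⟩⟩
    rw [IrrClass.deg, ← finrank_end_eq_of_equiv e]
    exact finrank_eq_one_of_isAbsolutelyIrreducible (Quotient.out x.2).2.2
  choose r hr he using hex
  have hinj : Function.Injective r := by
    rintro ⟨n, a⟩ ⟨m, b⟩ h
    have hnm : n = m := PNat.eq (by rw [← hr ⟨n, a⟩, ← hr ⟨m, b⟩, h])
    subst hnm
    obtain ⟨e⟩ := he ⟨n, a⟩
    obtain ⟨e'⟩ := he ⟨n, b⟩
    rw [h] at e
    have : a = b := by
      rw [← Quotient.out_eq a, ← Quotient.out_eq b]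
      exact Quotient.sound ⟨e.trans e'.symm⟩
    rw [this]
  simp only [rStar_mul]
  rw [← ENNReal.tsum_sigma' fun x : Σ n : ℕ+, Quotient (AbsIrrep.setoid G F n) =>
    (Nat.card F : ℝ≥0∞) ^ (-(t * (x.1 : ℕ)) + (x.1 : ℕ) - 1)]
  refine le_trans (ENNReal.tsum_le_tsum fun x => ?_)
    (ENNReal.tsum_comp_le_tsum_of_injective hinj fun c => c.1.weight t)
  rw [IrrClass.weight, hr x, (r x).2, Nat.cast_one]

/-- An irreducible representation over a finite field is determined by an absolutely irreducible
representation over an extension field. -/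
theorem irrSum_le_tsum_rStar (p : Nat.Primes) (j : ℕ+) (t : ℝ) :
    haveI : Fact (p : ℕ).Prime := ⟨p.2⟩
    irrSum G (GaloisField p j) t ≤
      ∑' (l : ℕ+) (d : ℕ+), (rStar G (GaloisField p (j * l : ℕ+)) d : ℝ≥0∞) *
        ((p : ℕ) : ℝ≥0∞) ^ (((j * l : ℕ+) : ℕ) * (-(t * (d : ℕ)) + (d : ℕ) - 1) : ℝ) := by
  have : Fact (p : ℕ).Prime := ⟨p.2⟩
  have hemb : ∀ l : ℕ+, Nonempty
      (GaloisField p j →ₐ[ZMod p] GaloisField p (j * l : ℕ+)) := fun l => by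
    refine FiniteField.nonempty_algHom_of_finrank_dvd ?_
    rw [GaloisField.finrank _ j.ne_zero, GaloisField.finrank _ (j * l).ne_zero, PNat.mul_coe]
    exact dvd_mul_right _ _
  let ι : ∀ l : ℕ+, GaloisField p j →ₐ[ZMod p] GaloisField p (j * l : ℕ+) := fun l =>
    (hemb l).some
  have hcard : ∀ k : ℕ+, Nat.card (GaloisField p k) = (p : ℕ) ^ (k : ℕ) := fun k =>
    GaloisField.card _ _ k.ne_zero
  -- Says that c is the restriction of scalars of x along the embedding ι fixed once for each l.
  -- Fixing it makes c recoverable from x.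
  let P : IrrClass G (GaloisField p j) → (Σ (l : ℕ+) (d : ℕ+),
      Quotient (AbsIrrep.setoid G (GaloisField p (j * l : ℕ+)) d)) → Prop := fun c x =>
    ∃ e : (Fin c.dim → GaloisField p j) ≃+ (Fin x.2.1 → GaloisField p (j * x.1 : ℕ+)),
      (∀ a v, e (a • v) = ι x.1 a • e v) ∧
      ∀ g v, e (c.rep g v) = (Quotient.out x.2.2).1 g (e v)
  have hP : ∀ x c c', P c x → P c' x → c = c' := by
    rintro x c c' ⟨e, he1, he2⟩ ⟨e', he1', he2'⟩
    let f : (Fin c.dim → GaloisField p j) ≃+ (Fin c'.dim → GaloisField p j) := e.trans e'.symm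
    have hf : ∀ v, e' (f v) = e v := fun v => e'.apply_symm_apply _
    refine IrrClass.eq_of_equiv (Representation.Equiv.mk
      (f.toLinearEquiv fun a v => e'.injective ?_) fun g => LinearMap.ext fun v => e'.injective ?_)
    · change e' (f (a • v)) = e' (a • f v)
      rw [hf, he1, he1', hf]
    · change e' (f (c.rep g v)) = e' (c'.rep g (f v))
      rw [hf, he2, he2', hf]
  have hex : ∀ c : IrrClass G (GaloisField p j),
      ∃ x, c.deg = x.1 ∧ c.dim = x.1 * x.2.1 ∧ P c x := by
    intro c
    let l : ℕ+ := ⟨c.deg, c.deg_pos⟩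
    let _ : Algebra (GaloisField p j) (GaloisField p (j * l : ℕ+)) := (ι l).toRingHom.toAlgebra
    have hL : Module.finrank (GaloisField p j) (GaloisField p (j * l : ℕ+)) = c.deg := by
      have h1 := Module.natCard_eq_pow_finrank (K := GaloisField p j)
        (V := GaloisField p (j * l : ℕ+))
      rw [hcard, hcard, ← pow_mul] at h1
      have h2 := (PNat.mul_coe j l).symm.trans (Nat.pow_right_injective p.2.two_le h1)
      exact (Nat.eq_of_mul_eq_mul_left j.pos h2).symm
    obtain ⟨d, σ, e, he1, he2, hσ, hd⟩ :=
      exists_isAbsolutelyIrreducible_restrictScalars c.isIrreducible hL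
    have hd' : c.deg * d = c.dim := by simpa using! hd
    have hdpos : 0 < d := Nat.pos_of_ne_zero fun h => by
      rw [h, mul_zero] at hd'
      exact c.dim_pos.ne hd'
    have hker : IsOpen {g | σ g = 1} := by
      convert c.isOpen_ker using 2
      ext g
      constructor
      · intro h
        refine LinearMap.ext fun v => e.injective ?_
        rw [he2, h]; rfl
      · intro h
        refine LinearMap.ext fun w => ?_
        obtain ⟨v, rfl⟩ := e.surjective w
        rw [← he2, h]; rfl
    let a : AbsIrrep G (GaloisField p (j * l : ℕ+)) d := ⟨σ, hker, hσ⟩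
    obtain ⟨f⟩ : Nonempty (Equiv (Quotient.out (Quotient.mk (AbsIrrep.setoid G _ d) a)).1 σ) :=
      Quotient.mk_out (s := AbsIrrep.setoid G _ d) a
    refine ⟨⟨l, ⟨d, hdpos⟩, Quotient.mk _ a⟩, rfl, hd'.symm,
      e.trans f.symm.toLinearEquiv.toAddEquiv, fun b v => ?_, fun g v => ?_⟩
    · change f.symm.toLinearEquiv (e (b • v)) = _ • f.symm.toLinearEquiv (e v)
      rw [he1, map_smul]
      rfl
    · change f.symm (e (c.rep g v)) = _
      rw [he2]
      exact f.symm.toIntertwiningMap.isIntertwining _ _ g (e v)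
  choose r hdeg hdim hr using hex
  have hinj : Function.Injective r := fun c c' h => hP (r c) c c' (hr c) (h ▸ hr c')
  simp only [rStar_mul]
  let w : (Σ (l : ℕ+) (d : ℕ+), Quotient (AbsIrrep.setoid G (GaloisField p (j * l : ℕ+)) d)) →
    ℝ≥0∞ := fun x => ((p : ℕ) : ℝ≥0∞) ^
      (((j * x.1 : ℕ+) : ℕ) * (-(t * (x.2.1 : ℕ)) + (x.2.1 : ℕ) - 1) : ℝ)
  calc irrSum G (GaloisField p j) t = ∑' c : IrrClass G (GaloisField p j), w (r c) := by
        refine tsum_congr fun c => ?_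
        rw [IrrClass.weight, hcard, hdeg, hdim, Nat.cast_pow, ← ENNReal.rpow_natCast,
          ← ENNReal.rpow_mul]
        congr 1
        have hm : (((j * (r c).1 : ℕ+) : ℕ) : ℝ) = (j : ℕ) * ((r c).1 : ℕ) := by
          rw [PNat.mul_coe, Nat.cast_mul]
        rw [hm]
        push_cast
        ring
    _ ≤ ∑' x, w x := ENNReal.tsum_comp_le_tsum_of_injective hinj w
    _ = _ := by
        rw [ENNReal.tsum_sigma']
        exact tsum_congr fun l => ENNReal.tsum_sigma' _

end Counting

end WeilZeta

namespace Representation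

lemma isIrreducible_comp_of_surjective {G Q F V : Type*} [Group G] [Group Q] [Field F]
    [AddCommGroup V] [Module F V] {ρ : Representation F Q V} (hρ : ρ.IsIrreducible) {π : G →* Q}
    (hπ : Function.Surjective π) : IsIrreducible (ρ.comp π : Representation F G V) := by
  have := nontrivial_of_isIrreducible hρ
  refine isIrreducible_of_forall ?_
  rintro S ⟨x, hx, hx0⟩ y
  let S' : Subrepresentation ρ :=
    { toSubmodule := S.toSubmodule
      apply_mem_toSubmodule := fun q v hv => by
        obtain ⟨g, rfl⟩ := hπ q
        exact S.apply_mem_toSubmodule g hv }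
  have : S' = ⊤ := (hρ.eq_bot_or_eq_top S').resolve_left fun h => hx0 (by
    have hx' : x ∈ S' := hx
    rwa [h] at hx')
  have hy : y ∈ S' := by rw [this]; trivial
  exact hy

end Representation

/-! ### Totals over all finite fields and comparison with the zeta function -/

namespace WeilZeta
open Representation
universe u v

/-- The contribution of the irreducible representations over all finite fields. -/
def irrTotal (G : Type u) [Group G] [TopologicalSpace G] (t : ℝ) : ℝ≥0∞ :=
  ∑' (p : Nat.Primes) (j : ℕ+),
    haveI : Fact (p : ℕ).Prime := ⟨p.2⟩
    irrSum G (GaloisField p j) t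

/-- The contribution of the irreducible representations with only scalar endomorphisms over all
finite fields. -/
def absTotal (G : Type u) [Group G] [TopologicalSpace G] (t : ℝ) : ℝ≥0∞ :=
  ∑' (p : Nat.Primes) (j : ℕ+),
    haveI : Fact (p : ℕ).Prime := ⟨p.2⟩
    absSum G (GaloisField p j) t

section Bounds

lemma pow_le_projCard (F : Type v) [Field F] [Finite F] (n : ℕ+) :
    Nat.card F ^ ((n : ℕ) - 1) ≤ projCard F n := by
  rw [projCard, Projectivization.card_of_finrank F _ (Module.finrank_fin_fun F)]
  exact Finset.single_le_sum (f := fun i => Nat.card F ^ i) (fun _ _ => Nat.zero_le _)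
    (Finset.mem_range.2 (Nat.sub_lt n.pos one_pos))

lemma projCard_le (F : Type v) [Field F] [Finite F] (n : ℕ+) :
    projCard F n ≤ 2 * Nat.card F ^ ((n : ℕ) - 1) := by
  rw [projCard, Projectivization.card_of_finrank F _ (Module.finrank_fin_fun F)]
  obtain ⟨m, hm⟩ := Nat.exists_eq_add_of_lt n.pos
  rw [hm]
  simp only [zero_add, Nat.add_sub_cancel]
  have hq : 2 ≤ Nat.card F := Finite.one_lt_card
  clear hm
  induction m with
  | zero => simp
  | succ m ih =>
    rw [Finset.sum_range_succ, pow_succ]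
    nlinarith [pow_pos (show 0 < Nat.card F by omega) m]

lemma rpow_mul_pow (p : Nat.Primes) (j n : ℕ+) (t : ℝ) :
    haveI : Fact (p : ℕ).Prime := ⟨p.2⟩
    ((p : ℕ) : ℝ≥0∞) ^ (-(t * (n : ℕ) * (j : ℕ))) *
      ((Nat.card (GaloisField p j) ^ ((n : ℕ) - 1) : ℕ) : ℝ≥0∞) =
    (Nat.card (GaloisField p j) : ℝ≥0∞) ^ (-(t * (n : ℕ)) + (n : ℕ) - 1) := by
  have : Fact (p : ℕ).Prime := ⟨p.2⟩
  have hp0 : ((p : ℕ) : ℝ≥0∞) ≠ 0 := by exact_mod_cast p.2.ne_zero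
  rw [GaloisField.card _ _ j.ne_zero, Nat.cast_pow, Nat.cast_pow, ← pow_mul,
    ← ENNReal.rpow_natCast, ← ENNReal.rpow_natCast, ← ENNReal.rpow_mul,
    ← ENNReal.rpow_add _ _ hp0 (ENNReal.natCast_ne_top _)]
  congr 1
  rw [Nat.cast_mul, Nat.cast_sub (show 1 ≤ (n : ℕ) from n.pos)]
  push_cast
  ring

variable {G : Type u} [Group G] [TopologicalSpace G]

lemma logZeta_term_le (p : Nat.Primes) (j n : ℕ+) (t : ℝ) :
    haveI : Fact (p : ℕ).Prime := ⟨p.2⟩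
    (rStar G (GaloisField p j) n : ℝ≥0∞) / (j : ℕ) *
      ((p : ℕ) : ℝ≥0∞) ^ (-(t * (n : ℕ) * (j : ℕ))) * (projCard (GaloisField p j) n : ℝ≥0∞) ≤
    2 * ((rStar G (GaloisField p j) n : ℝ≥0∞) *
      (Nat.card (GaloisField p j) : ℝ≥0∞) ^ (-(t * (n : ℕ)) + (n : ℕ) - 1)) := by
  have : Fact (p : ℕ).Prime := ⟨p.2⟩
  rw [← rpow_mul_pow]
  have h1 : (rStar G (GaloisField p j) n : ℝ≥0∞) / (j : ℕ) ≤ rStar G (GaloisField p j) n :=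
    ENNReal.div_le_of_le_mul (le_mul_of_one_le_right' (by exact_mod_cast j.pos))
  have h2 : (projCard (GaloisField p j) n : ℝ≥0∞) ≤
      2 * ((Nat.card (GaloisField p j) ^ ((n : ℕ) - 1) : ℕ) : ℝ≥0∞) := by
    exact_mod_cast projCard_le (GaloisField p j) n
  refine (mul_le_mul' (mul_le_mul_left h1 _) h2).trans (le_of_eq ?_)
  ring

theorem logZeta_le_absTotal (t : ℝ) : logZeta G t ≤ 2 * absTotal G t := by
  rw [logZeta, absTotal, ← ENNReal.tsum_mul_left]
  refine ENNReal.tsum_le_tsum fun p => ?_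
  have : Fact (p : ℕ).Prime := ⟨p.2⟩
  rw [ENNReal.tsum_comm, ← ENNReal.tsum_mul_left]
  refine ENNReal.tsum_le_tsum fun j => ?_
  refine (ENNReal.tsum_le_tsum fun n => logZeta_term_le p j n t).trans ?_
  rw [ENNReal.tsum_mul_left]
  exact mul_le_mul_right (tsum_rStar_le_absSum t) _

theorem irrTotal_lt_top {t ε : ℝ} (hε : 0 < ε) (h : logZeta G t < ⊤) :
    irrTotal G (t + ε) < ⊤ := by
  obtain ⟨C, hC, hCn⟩ := exists_mul_rpow_le (half_pos hε)
  suffices hle : irrTotal G (t + ε) ≤ C ^ 2 * logZeta G t from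
    hle.trans_lt (ENNReal.mul_lt_top (ENNReal.pow_lt_top hC.lt_top) h)
  rw [logZeta, irrTotal, ← ENNReal.tsum_mul_left]
  refine ENNReal.tsum_le_tsum fun p => ?_
  have : Fact (p : ℕ).Prime := ⟨p.2⟩
  have hp0 : ((p : ℕ) : ℝ≥0∞) ≠ 0 := by exact_mod_cast p.2.ne_zero
  have hpt : ((p : ℕ) : ℝ≥0∞) ≠ ⊤ := ENNReal.natCast_ne_top _
  refine (ENNReal.tsum_le_tsum fun j => irrSum_le_tsum_rStar p j (t + ε)).trans ?_
  refine (tsum_mul_le fun k => ∑' d : ℕ+, (rStar G (GaloisField p k) d : ℝ≥0∞) *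
    ((p : ℕ) : ℝ≥0∞) ^ ((k : ℕ) * (-((t + ε) * (d : ℕ)) + (d : ℕ) - 1) : ℝ)).trans ?_
  rw [ENNReal.tsum_comm, ← ENNReal.tsum_mul_left]
  refine ENNReal.tsum_le_tsum fun k => ?_
  rw [← ENNReal.tsum_mul_left, ← ENNReal.tsum_mul_left]
  refine ENNReal.tsum_le_tsum fun d => ?_
  have hk0 : ((k : ℕ) : ℝ≥0∞) ≠ 0 := by exact_mod_cast k.ne_zero
  have hkt : ((k : ℕ) : ℝ≥0∞) ≠ ⊤ := ENNReal.natCast_ne_top _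
  have h1 : ((p : ℕ) : ℝ≥0∞) ^ ((k : ℕ) * (-((t + ε) * (d : ℕ)) + (d : ℕ) - 1) : ℝ) ≤
      ((p : ℕ) : ℝ≥0∞) ^ (-(t * (d : ℕ) * (k : ℕ))) *
      ((Nat.card (GaloisField p k) ^ ((d : ℕ) - 1) : ℕ) : ℝ≥0∞) *
      (((p : ℕ) : ℝ≥0∞) ^ (-(ε / 2 * (k : ℕ))) * ((p : ℕ) : ℝ≥0∞) ^ (-(ε / 2 * (k : ℕ)))) := by
    rw [rpow_mul_pow, GaloisField.card _ _ k.ne_zero, Nat.cast_pow, ← ENNReal.rpow_natCast,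
      ← ENNReal.rpow_mul, ← ENNReal.rpow_add _ _ hp0 hpt, ← ENNReal.rpow_add _ _ hp0 hpt]
    refine ENNReal.rpow_le_rpow_of_exponent_le (by exact_mod_cast p.2.one_le) ?_
    have hd : (1 : ℝ) ≤ (d : ℕ) := by exact_mod_cast d.pos
    have hk : (1 : ℝ) ≤ (k : ℕ) := by exact_mod_cast k.pos
    nlinarith [mul_nonneg (mul_nonneg hε.le (sub_nonneg.2 hd)) (zero_le_one.trans hk)]
  have h2 : ((Nat.card (GaloisField p k) ^ ((d : ℕ) - 1) : ℕ) : ℝ≥0∞) ≤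
      projCard (GaloisField p k) d := by exact_mod_cast pow_le_projCard (GaloisField p k) d
  have h3 := hCn p p.2.two_le k
  -- One factor k counts factorizations and another restores the denominator k of the zeta series;
  -- each is absorbed by half of ε.
  calc ((k : ℕ) : ℝ≥0∞) * ((rStar G (GaloisField p k) d : ℝ≥0∞) * _)
      ≤ (k : ℕ) * ((rStar G (GaloisField p k) d : ℝ≥0∞) * _) :=
        mul_le_mul_right (mul_le_mul_right h1 _) _
    _ = ((k : ℕ) * ((p : ℕ) : ℝ≥0∞) ^ (-(ε / 2 * (k : ℕ)))) ^ 2 *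
        ((rStar G (GaloisField p k) d : ℝ≥0∞) / (k : ℕ) *
          ((p : ℕ) : ℝ≥0∞) ^ (-(t * (d : ℕ) * (k : ℕ))) *
          ((Nat.card (GaloisField p k) ^ ((d : ℕ) - 1) : ℕ) : ℝ≥0∞)) := by
        have : ((k : ℕ) : ℝ≥0∞) = (k : ℕ) ^ 2 * ((k : ℕ) : ℝ≥0∞)⁻¹ := by
          rw [pow_two, mul_assoc, ENNReal.mul_inv_cancel hk0 hkt, mul_one]
        rw [ENNReal.div_eq_inv_mul, mul_pow]
        conv_lhs => rw [this]
        ring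
    _ ≤ _ := mul_le_mul' (pow_le_pow_left' h3 2) (mul_le_mul_right h2 _)

theorem logZeta_antitone {s t : ℝ} (hst : s ≤ t) : logZeta G t ≤ logZeta G s := by
  refine ENNReal.tsum_le_tsum fun p => ENNReal.tsum_le_tsum fun n => ENNReal.tsum_le_tsum fun j =>
    mul_le_mul_left (mul_le_mul_right ?_ _) _
  refine ENNReal.rpow_le_rpow_of_exponent_le (by exact_mod_cast p.2.one_le) ?_
  have h : (0 : ℝ) ≤ (n : ℕ) * (j : ℕ) := by positivity
  nlinarith

end Bounds

/-! ### The abscissa of convergence -/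

section Abscissa

variable {G : Type u} [Group G] [TopologicalSpace G] {H : Type v} [Group H] [TopologicalSpace H]

lemma one_le_abscissa : (1 : EReal) ≤ abscissa G := by
  refine le_sInf ?_
  rintro _ ⟨t, ⟨ht, -⟩, rfl⟩
  change (1 : EReal) ≤ (t : EReal)
  exact_mod_cast ht

lemma abscissa_le {t : ℝ} (ht : 1 ≤ t) (h : logZeta G t < ⊤) : abscissa G ≤ t :=
  sInf_le ⟨t, ⟨ht, h⟩, rfl⟩

lemma abscissa_le_of_forall {a : ℝ} (ha : 1 ≤ a) (h : ∀ ε > 0, logZeta G (a + ε) < ⊤) :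
    abscissa G ≤ a := by
  refine EReal.le_of_forall_lt_iff_le.1 fun z hz => ?_
  have hz' : a < z := by exact_mod_cast hz
  have := h (z - a) (by linarith)
  rw [add_sub_cancel] at this
  exact abscissa_le (by linarith) this

/-- Monotonicity in t turns the infimum into convergence at every point strictly to its right. -/
lemma abscissa_eq_top_or : abscissa G = ⊤ ∨
    ∃ a : ℝ, 1 ≤ a ∧ abscissa G = a ∧ ∀ ε > 0, logZeta G (a + ε) < ⊤ := by
  by_cases h : abscissa G = ⊤
  · exact Or.inl h
  have hbot : abscissa G ≠ ⊥ := fun h' => by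
    have := one_le_abscissa (G := G)
    rw [h'] at this
    exact absurd this (by decide)
  refine Or.inr ⟨(abscissa G).toReal, ?_, (EReal.coe_toReal h hbot).symm, fun ε hε => ?_⟩
  · have := one_le_abscissa (G := G)
    rw [← EReal.coe_toReal h hbot] at this
    exact_mod_cast this
  · have hlt : abscissa G < (((abscissa G).toReal + ε : ℝ) : EReal) := by
      conv_lhs => rw [← EReal.coe_toReal h hbot]
      exact_mod_cast lt_add_of_pos_right _ hε
    obtain ⟨_, ⟨t, ⟨-, ht⟩, rfl⟩, htlt⟩ := sInf_lt_iff.1 hlt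
    exact (logZeta_antitone (EReal.coe_lt_coe_iff.1 htlt).le).trans_lt ht

/-- Convergence at `t` follows from a comparison over all finite fields. -/
theorem logZeta_lt_top_of_absSum_le {s s' t : ℝ} (hs : s' < s) (hconv : logZeta H s' < ⊤) (M : ℕ)
    (h : ∀ (F : Type) [Field F] [Finite F], absSum G F t ≤ M * irrSum H F s) :
    logZeta G t < ⊤ := by
  have h1 : irrTotal H s < ⊤ := by
    have := irrTotal_lt_top (sub_pos.2 hs) hconv
    rwa [add_sub_cancel] at this
  have h2 : absTotal G t ≤ M * irrTotal H s := by
    rw [absTotal, irrTotal, ← ENNReal.tsum_mul_left]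
    refine ENNReal.tsum_le_tsum fun p => ?_
    rw [← ENNReal.tsum_mul_left]
    refine ENNReal.tsum_le_tsum fun j => ?_
    have : Fact (p : ℕ).Prime := ⟨p.2⟩
    exact h _
  exact (logZeta_le_absTotal t).trans_lt (ENNReal.mul_lt_top (by simp)
    (h2.trans_lt (ENNReal.mul_lt_top (by simp) h1)))

/-- Inflation along π keeps the invariant subspaces, also over F̄, and reflects isomorphism. -/
theorem rStar_le_of_surjective {π : G →* H} (hπ : Function.Surjective π) (hc : Continuous π)
    (F : Type) [Field F] (n : ℕ) : rStar H F n ≤ rStar G F n := by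
  let f : AbsIrrep H F n → AbsIrrep G F n := fun ρ =>
    ⟨ρ.1.comp π, isOpen_ker_comp ρ.2.1 hc, isIrreducible_comp_of_surjective ρ.2.2.1 hπ,
      isIrreducible_comp_of_surjective ρ.2.2.2 hπ⟩
  let f' : Quotient (AbsIrrep.setoid H F n) → Quotient (AbsIrrep.setoid G F n) := fun a =>
    Quotient.mk _ (f a.out)
  refine ENat.card_le_card_of_injective (f := f') fun a b hab => ?_
  obtain ⟨e⟩ := Quotient.exact hab
  rw [← Quotient.out_eq a, ← Quotient.out_eq b]
  refine Quotient.sound ⟨Representation.Equiv.mk e.toLinearEquiv fun x => ?_⟩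
  obtain ⟨g, rfl⟩ := hπ x
  exact e.toIntertwiningMap.isIntertwining' g

theorem abscissa_le_of_surjective {π : G →* H} (hπ : Function.Surjective π)
    (hc : Continuous π) : abscissa H ≤ abscissa G := by
  have h : ∀ t, logZeta H t ≤ logZeta G t := fun t => by
    refine ENNReal.tsum_le_tsum fun p => ENNReal.tsum_le_tsum fun n =>
      ENNReal.tsum_le_tsum fun j => mul_le_mul_left (mul_le_mul_left ?_ _) _
    have : Fact (p : ℕ).Prime := ⟨p.2⟩
    refine ENNReal.div_le_div_right ?_ _
    exact_mod_cast rStar_le_of_surjective hπ hc (GaloisField p j) n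
  exact sInf_le_sInf (Set.image_mono fun t ht => ⟨ht.1, (h t).trans_lt ht.2⟩)

theorem UBERG.abscissa_lt_top (h : UBERG G) : abscissa G < ⊤ := by
  obtain ⟨c, hc, hG⟩ := h
  -- At c + 3 the exponent of q becomes cn - (c+3)n + n - 1 = -2n - 1 ≤ -2 - n: q^(-2) for the sum
  -- over fields and at most 2^(-n) for the sum over dimensions.
  refine (abscissa_le (t := c + 3) (by linarith) ?_).trans_lt (EReal.coe_lt_top _)
  have hle : logZeta G (c + 3) ≤ ∑' (p : Nat.Primes) (j : ℕ+) (n : ℕ+),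
      2 * ((((p : ℕ) ^ (j : ℕ) : ℕ) : ℝ≥0∞) ^ (-(2 : ℝ)) * 2⁻¹ ^ (n : ℕ)) := by
    refine ENNReal.tsum_le_tsum fun p => ?_
    have : Fact (p : ℕ).Prime := ⟨p.2⟩
    rw [ENNReal.tsum_comm]
    refine ENNReal.tsum_le_tsum fun j => ENNReal.tsum_le_tsum fun n => ?_
    refine (logZeta_term_le p j n _).trans (mul_le_mul_right ?_ _)
    have hq0 : (Nat.card (GaloisField p j) : ℝ≥0∞) ≠ 0 := by
      exact_mod_cast (Nat.card_pos (α := GaloisField p j)).ne'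
    refine (mul_le_mul_left (hG (GaloisField p j) n) _).trans ?_
    rw [← ENNReal.rpow_add _ _ hq0 (ENNReal.natCast_ne_top _),
      ← GaloisField.card (p : ℕ) (j : ℕ) j.ne_zero]
    have h1 : (2 : ℝ≥0∞)⁻¹ ^ (n : ℕ) ≥
        (Nat.card (GaloisField p j) : ℝ≥0∞) ^ (-((n : ℕ) : ℝ)) := by
      rw [ENNReal.rpow_neg, ENNReal.rpow_natCast, ← ENNReal.inv_pow, ge_iff_le,
        ENNReal.inv_le_inv]
      exact pow_le_pow_left' (by exact_mod_cast Finite.one_lt_card (α := GaloisField p j)) _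
    refine le_trans ?_ (mul_le_mul_right h1 _)
    rw [← ENNReal.rpow_add _ _ hq0 (ENNReal.natCast_ne_top _)]
    refine ENNReal.rpow_le_rpow_of_exponent_le (one_le_card _) ?_
    have hn : (1 : ℝ) ≤ (n : ℕ) := by exact_mod_cast n.pos
    nlinarith
  refine hle.trans_lt ?_
  simp only [ENNReal.tsum_mul_left, ENNReal.tsum_mul_right]
  refine ENNReal.mul_lt_top (by simp) (ENNReal.mul_lt_top
    (tsum_prime_pow_ne_top one_lt_two).lt_top ?_)
  refine (ENNReal.tsum_comp_le_tsum_of_injective PNat.coe_injective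
    fun n : ℕ => (2 : ℝ≥0∞)⁻¹ ^ n).trans_lt ?_
  rw [ENNReal.tsum_geometric]
  simp

lemma irrSum_unit_le (F : Type) [Field F] [Finite F] (t : ℝ) :
    irrSum Unit F t ≤ (Nat.card F : ℝ≥0∞) ^ (-t) := by
  have hdim : ∀ c : IrrClass Unit F, c.dim = 1 := by
    intro c
    obtain ⟨v, hv⟩ := @exists_ne _ c.nontrivial (0 : Fin c.dim → F)
    let S : Subrepresentation c.rep :=
      { toSubmodule := F ∙ v
        apply_mem_toSubmodule := fun g w hw => by
          rw [Subsingleton.elim g 1, map_one]; exact hw }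
    have hS : S = ⊤ := (c.isIrreducible.eq_bot_or_eq_top S).resolve_left fun h => hv (by
      have : v ∈ S := Submodule.mem_span_singleton_self v
      rw [h] at this
      exact this)
    have h1 : Module.finrank F S.toSubmodule = 1 := finrank_span_singleton hv
    rw [hS] at h1
    have h2 : Module.finrank F (⊤ : Subrepresentation c.rep).toSubmodule = c.dim :=
      (finrank_top F _).trans (by simp)
    exact h2.symm.trans h1
  have hsub : Subsingleton (IrrClass Unit F) := ⟨fun c d => by
    let e : (Fin c.dim → F) ≃ₗ[F] (Fin d.dim → F) :=
      LinearEquiv.ofFinrankEq _ _ (by simp [hdim])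
    refine IrrClass.eq_of_equiv (Representation.Equiv.mk e fun g => ?_)
    rw [Subsingleton.elim g 1, map_one, map_one]
    rfl⟩
  rw [irrSum]
  rcases isEmpty_or_nonempty (IrrClass Unit F) with h | ⟨⟨c⟩⟩
  · simp
  · rw [tsum_eq_single c fun d hd => absurd (Subsingleton.elim d c) hd, IrrClass.weight, hdim,
      le_antisymm ((c.deg_le_dim).trans_eq (hdim c)) c.deg_pos]
    simp

/-- The trivial group commutes with everything, so the bound for commuting generators applies with R
= G. What remains is ∑ q^(-1-ε) over prime powers. -/
lemma abscissa_of_finite [Finite G] : abscissa G = 1 := by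
  classical
  have := Fintype.ofFinite G
  refine le_antisymm ?_ one_le_abscissa
  refine abscissa_le_of_forall (a := 1) le_rfl fun ε hε => ?_
  have h2 : absTotal G (1 + ε) ≤ (Finset.univ : Finset G).card * ∑' (p : Nat.Primes) (j : ℕ+),
      (((p : ℕ) ^ (j : ℕ) : ℕ) : ℝ≥0∞) ^ (-(1 + ε)) := by
    rw [absTotal, ← ENNReal.tsum_mul_left]
    refine ENNReal.tsum_le_tsum fun p => ?_
    rw [← ENNReal.tsum_mul_left]
    refine ENNReal.tsum_le_tsum fun j => ?_
    have : Fact (p : ℕ).Prime := ⟨p.2⟩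
    rw [← GaloisField.card (p : ℕ) (j : ℕ) j.ne_zero]
    refine (absSum_le_irrSum_of_commute (φ := (1 : Unit →* G)) continuous_const Finset.univ
      (fun g => ⟨g, Finset.mem_univ _, 1, by simp⟩) (by simp) (by linarith)).trans ?_
    exact mul_le_mul_right (irrSum_unit_le _ _) _
  exact (logZeta_le_absTotal _).trans_lt (ENNReal.mul_lt_top (by simp) (h2.trans_lt
    (ENNReal.mul_lt_top (by simp) (tsum_prime_pow_ne_top (by linarith)).lt_top)))

end Abscissa

/-! ### Open subgroups, finite direct factors and split extensions -/

lemma exists_transversal {G : Type*} [Group G] [TopologicalSpace G]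
    [IsTopologicalGroup G] [CompactSpace G] (H : Subgroup G) (hH : IsOpen (H : Set G)) :
    ∃ R : Finset G, R.card = H.index ∧ ∀ g, ∃ r ∈ R, ∃ h, g = r * H.subtype h := by
  classical
  have : Finite (G ⧸ H) := Subgroup.quotient_finite_of_isOpen H hH
  have := Fintype.ofFinite (G ⧸ H)
  refine ⟨Finset.univ.image (Quotient.out : G ⧸ H → G), ?_, fun g => ?_⟩
  · rw [Finset.card_image_of_injective _ Quotient.out_injective, Finset.card_univ,
      ← Nat.card_eq_fintype_card]
    rfl
  · refine ⟨(g : G ⧸ H).out, by simp, ⟨(g : G ⧸ H).out⁻¹ * g, ?_⟩, by simp⟩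
    exact QuotientGroup.eq.1 (Quotient.out_eq (g : G ⧸ H))

theorem abscissa_subgroup {G : Type*} [Group G] [TopologicalSpace G] [IsTopologicalGroup G]
    [CompactSpace G] [TotallyDisconnectedSpace G] (H : Subgroup G) (hH : IsOpen (H : Set G)) :
    abscissa H / ((H.index : ℝ) : EReal) ≤ abscissa G ∧
      abscissa G ≤ abscissa H + ((1 - 1 / (H.index : ℝ) : ℝ) : EReal) := by
  obtain ⟨R, hRc, hR⟩ := exists_transversal H hH
  have hpos : 1 ≤ R.card := by
    obtain ⟨x, hx, -⟩ := hR 1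
    exact Finset.card_pos.2 ⟨x, hx⟩
  rw [← hRc]
  have hm : (1 : ℝ) ≤ R.card := by exact_mod_cast hpos
  have hinv : 1 / (R.card : ℝ) ≤ 1 := by
    rw [div_le_one (by linarith)]
    exact hm
  constructor
  · rcases abscissa_eq_top_or (G := G) with h | ⟨a, ha, haG, hconv⟩
    · rw [h]; exact le_top
    · rw [haG, EReal.div_le_iff_le_mul (by exact_mod_cast zero_lt_one.trans_le hm)
        (EReal.coe_ne_top _), ← EReal.coe_mul]
      refine abscissa_le_of_forall (by nlinarith) fun ε hε => ?_
      have hm0 : (R.card : ℝ) ≠ 0 := by positivity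
      have hδ : 0 < ε / R.card := by positivity
      -- The subgroup is evaluated at |R| times the argument of the group, so ε must be divided by
      -- |R|.
      have h1 : (R.card : ℝ) * a + ε = R.card * (a + ε / R.card) := by
        rw [mul_add, mul_div_cancel₀ _ hm0]
      rw [h1]
      refine logZeta_lt_top_of_absSum_le (H := G) (s := a + ε / R.card)
        (s' := a + ε / R.card / 2) (by linarith) (hconv _ (half_pos hδ)) R.card fun F _ _ => ?_
      exact absSum_subgroup_le_irrSum H hH R hR (by linarith)
  · rcases abscissa_eq_top_or (G := H) with h | ⟨a, ha, haH, hconv⟩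
    · rw [h, EReal.top_add_coe]; exact le_top
    · rw [haH, ← EReal.coe_add]
      refine abscissa_le_of_forall (by linarith) fun ε hε => ?_
      have h1 : a + (1 - 1 / (R.card : ℝ)) + ε = (a + ε) + 1 - 1 / R.card := by ring
      rw [h1]
      refine logZeta_lt_top_of_absSum_le (H := H) (s := a + ε)
        (s' := a + ε / 2) (by linarith) (hconv _ (half_pos hε)) R.card fun F _ _ => ?_
      exact absSum_le_irrSum (φ := H.subtype) continuous_subtype_val R hR (by linarith)

theorem abscissa_prod {G : Type*} [Group G] [TopologicalSpace G] {H : Type*} [Group H]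
    [TopologicalSpace H] [IsTopologicalGroup H] {F : Type*} [Group F] [TopologicalSpace F]
    [Finite F] (e : G ≃ₜ* H × F) : abscissa G = abscissa H := by
  classical
  have := Fintype.ofFinite F
  refine le_antisymm ?_ (abscissa_le_of_surjective
    (π := (MonoidHom.fst H F).comp e.toMulEquiv.toMonoidHom)
    (Prod.fst_surjective.comp e.toMulEquiv.surjective) (continuous_fst.comp e.continuous_toFun))
  rcases abscissa_eq_top_or (G := H) with h | ⟨a, ha, haH, hconv⟩
  · rw [h]; exact le_top
  rw [haH]
  refine abscissa_le_of_forall ha fun ε hε => ?_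
  -- The finite factor itself serves as a set of coset representatives commuting with H.
  let R : Finset G := Finset.univ.image fun x : F => e.symm (1, x)
  let φ : H →* G := e.symm.toMulEquiv.toMonoidHom.comp (MonoidHom.inl H F)
  have hφ : ∀ h, φ h = e.symm (h, 1) := fun _ => rfl
  refine logZeta_lt_top_of_absSum_le (H := H) (s := a + ε)
    (s' := a + ε / 2) (by linarith) (hconv _ (half_pos hε)) R.card fun F' _ _ => ?_
  refine absSum_le_irrSum_of_commute (φ := φ)
    (e.symm.continuous_toFun.comp (by fun_prop : Continuous fun h : H => (h, (1 : F)))) R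
    (fun g => ⟨e.symm (1, (e g).2), Finset.mem_image_of_mem _ (Finset.mem_univ _), (e g).1, ?_⟩)
    ?_ (by linarith)
  · rw [hφ, ← map_mul]
    simp
  · intro r hr h
    obtain ⟨x, -, rfl⟩ := Finset.mem_image.1 hr
    rw [hφ, ← map_mul, ← map_mul]
    simp

theorem abscissa_le_of_section {G : Type*} [Group G] [TopologicalSpace G] [IsTopologicalGroup G]
    (K : Subgroup G) [K.Normal] (σ : (G ⧸ K) →ₜ* G) (hσ : ∀ x : G ⧸ K, (σ x : G ⧸ K) = x) :
    abscissa G ≤ abscissa K + abscissa (G ⧸ K) + 1 := by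
  have hbot : ∀ {L : Type _} [Group L] [TopologicalSpace L], abscissa L ≠ ⊥ := fun {L} _ _ h => by
    have := one_le_abscissa (G := L)
    rw [h] at this
    exact absurd this (by decide)
  rcases abscissa_eq_top_or (G := K) with h | ⟨a, ha, haK, hconvK⟩
  · rw [h, EReal.top_add_of_ne_bot hbot]
    exact le_top
  rcases abscissa_eq_top_or (G := G ⧸ K) with h | ⟨b, hb, hbQ, hconvQ⟩
  · rw [h, EReal.add_top_of_ne_bot hbot]
    exact le_top
  rw [haK, hbQ, ← EReal.coe_add, ← EReal.coe_one, ← EReal.coe_add]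
  refine abscissa_le_of_forall (by linarith) fun ε hε => ?_
  -- One quarter of ε for convergence over K, one over G/K, and two for the multiplicities.
  have hε4 : 0 < ε / 4 := by positivity
  obtain ⟨C, hC, hCn⟩ := exists_mul_rpow_le hε4
  have h1 : a + b + 1 + ε = (a + ε / 4) + (b + ε / 4) + 1 + 2 * (ε / 4) := by ring
  rw [h1]
  have hirr : ∀ {L : Type _} [Group L] [TopologicalSpace L] {x : ℝ},
      (∀ ε > 0, logZeta L (x + ε) < ⊤) → irrTotal L (x + ε / 4) < ⊤ := fun {L} _ _ {x} h => by
    have := irrTotal_lt_top (half_pos hε4) (h _ (half_pos hε4))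
    rwa [add_assoc, add_halves] at this
  have hG : ∀ g : G, ∃ (q : G ⧸ K) (h : K), g = σ.toMonoidHom q * K.subtype h := fun g => by
    refine ⟨(g : G ⧸ K), ⟨(σ (g : G ⧸ K))⁻¹ * g, QuotientGroup.eq.1 (hσ _)⟩, ?_⟩
    change g = σ (g : G ⧸ K) * ((σ (g : G ⧸ K))⁻¹ * g)
    rw [mul_inv_cancel_left]
  have h2 : absTotal G ((a + ε / 4) + (b + ε / 4) + 1 + 2 * (ε / 4)) ≤
      C ^ 2 * (irrTotal K (a + ε / 4) * irrTotal (G ⧸ K) (b + ε / 4)) := by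
    rw [absTotal, irrTotal, irrTotal, ← ENNReal.tsum_mul_right, ← ENNReal.tsum_mul_left]
    refine ENNReal.tsum_le_tsum fun p => ?_
    rw [← ENNReal.tsum_mul_right, ← ENNReal.tsum_mul_left]
    refine ENNReal.tsum_le_tsum fun j => ?_
    have : Fact (p : ℕ).Prime := ⟨p.2⟩
    refine (absSum_le_of_split (F := GaloisField p j) (φ := K.subtype) continuous_subtype_val
      (σ := σ.toMonoidHom) σ.continuous_toFun hG (by linarith) (by linarith) hε4.le
      (hCn _ Finite.one_lt_card)).trans ?_
    -- A sum of products over the fields is at most the product of the sums: the factor of G/K at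
    -- one field is bounded by its total.
    refine mul_le_mul_right (mul_le_mul_right ?_ _) _
    exact (ENNReal.le_tsum (f := fun j : ℕ+ => irrSum (G ⧸ K) (GaloisField p j) (b + ε / 4)) j).trans
      (ENNReal.le_tsum (f := fun p : Nat.Primes => ∑' (j : ℕ+),
        haveI : Fact (p : ℕ).Prime := ⟨p.2⟩
        irrSum (G ⧸ K) (GaloisField p j) (b + ε / 4)) p)
  exact (logZeta_le_absTotal _).trans_lt (ENNReal.mul_lt_top (by simp) (h2.trans_lt
    (ENNReal.mul_lt_top (ENNReal.pow_lt_top hC.lt_top)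
      (ENNReal.mul_lt_top (hirr hconvK) (hirr hconvQ)))))

end WeilZeta

end

theorem theoremB {G : Type*} [Group G] [TopologicalSpace G] [IsTopologicalGroup G]
    [CompactSpace G] [TotallyDisconnectedSpace G] :
    -- for a UBERG group the abscissa is a real number, at least one
    (WeilZeta.UBERG G → 1 ≤ WeilZeta.abscissa G ∧ WeilZeta.abscissa G < ⊤) ∧
    -- open subgroups
    (∀ H : Subgroup G, IsOpen (H : Set G) →
      WeilZeta.abscissa H / ((H.index : ℝ) : EReal) ≤ WeilZeta.abscissa G ∧
      WeilZeta.abscissa G ≤ WeilZeta.abscissa H + ((1 - 1 / (H.index : ℝ) : ℝ) : EReal)) ∧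
    -- direct products with finite groups
    (∀ {H : Type*} [Group H] [TopologicalSpace H] [IsTopologicalGroup H]
      [CompactSpace H] [TotallyDisconnectedSpace H]
      {F : Type*} [Group F] [TopologicalSpace F] [DiscreteTopology F] [Finite F],
      (G ≃ₜ* H × F) → WeilZeta.abscissa G = WeilZeta.abscissa H) ∧
    -- quotients and split extensions
    (∀ (K : Subgroup G) [K.Normal], IsClosed (K : Set G) →
      WeilZeta.abscissa (G ⧸ K) ≤ WeilZeta.abscissa G ∧
      ((∃ σ : (G ⧸ K) →ₜ* G, ∀ x : G ⧸ K, (σ x : G ⧸ K) = x) →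
        WeilZeta.abscissa G ≤ WeilZeta.abscissa K + WeilZeta.abscissa (G ⧸ K) + 1)) ∧
    -- finite groups
    (Finite G → WeilZeta.abscissa G = 1) := by
  refine ⟨fun h => ⟨WeilZeta.one_le_abscissa, h.abscissa_lt_top⟩, WeilZeta.abscissa_subgroup,
    fun e => WeilZeta.abscissa_prod e, fun K _ _ => ⟨?_, ?_⟩,
    fun _ => WeilZeta.abscissa_of_finite⟩
  · exact WeilZeta.abscissa_le_of_surjective (π := QuotientGroup.mk' K)
      (QuotientGroup.mk'_surjective K) QuotientGroup.continuous_mk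
  · rintro ⟨σ, hσ⟩
    exact WeilZeta.abscissa_le_of_section K σ hσ
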